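/- For a finite set $P\subset\mathbb{R}^d$ let $\operatorname{ddim}(P)=\log_2 N$ (and $0$ if $P=\emptyset$), where $N$ is the least number such that for every ball of radius $r>0$ in $\mathbb{R}^d$ the points of $P$ in that ball can be covered by $N$ balls of radius $r/2$. A Gaussian JL map is a random $t\times d$ matrix $G$ with i.i.d. entries drawn from $N(0,\tfrac1t)$. For a map $f$ on $P$ into a Euclidean space, a matching $M$ of $P$ (a set of pairwise disjoint pairs of distinct points of $P$) has cost $\operatorname{cost}(f(M))=\sum_{\{p,q\}\in M}\|f(p)-f(q)\|$, and a tour $S$ (a cyclic ordering of all points of $P$) has cost equal to the sum of $\|f(p)-f(q)\|$ over its consecutive pairs $p,q$ (a tour of two points traverses their distance twice). Let $\operatorname{opt}_{\text{max-match}}(f(P))$ and $\operatorname{opt}_{\text{max-tsp}}(f(P))$ be the maxima of these costs over all matchings, respectively all tours. A solution is $c$-approximate for $f(P)$ if $c$ times its cost is at least the optimum; here $f$ is the identity (giving $P$) or $f=G$ (giving $G(P)$), and solutions for $G(P)$ and for $P$ are identified through $p\mapsto Gp$. There are universal constants $C,C'>0$ and a function $K:[1,\infty)\to\mathbb{R}$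 such that the following holds for all $0<\varepsilon<1$, all $d,\lambda\in\mathbb{N}$ (zero included), every integer $t\ge 0$ with $t\ge C\,\varepsilon^{-2}\lambda\log(2/\varepsilon)$, a Gaussian JL map $G\in\mathbb{R}^{t\times d}$ and every finite set $P\subset\mathbb{R}^d$ with $\operatorname{ddim}(P)\le\lambda$. 1. With probability at least $2/3$, simultaneously for maximum matching and maximum TSP: every $(1+\varepsilon)$-approximate solution for $G(P)$ is a $(1+C'\varepsilon)$-approximate solution for $P$; and for every $\kappa\ge1$, every $\kappa$-approximate solution for $G(P)$ is a $K(\kappa)$-approximate solution for $P$. 2. With probability at least $9/10$, every matching $M$ of $P$ satisfies $$\sum_{\{p,q\}\in M}\|Gp-Gq\|\le\sum_{\{p,q\}\in M}\|p-q\|+\varepsilon\cdot\operatorname{opt}_{\text{max-match}}(P).$$ -/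

import Mathlib

open MeasureTheory ProbabilityTheory
open scoped ENNReal NNReal

noncomputable section

namespace MaxReduction

/-- The doubling number of a finite set `P ⊆ ℝᵈ`: the least `N` such that for every ball of radius
`r`, the points of `P` in that ball can be covered by `N` balls of radius `r / 2`. -/
def doublingNumber {d : ℕ} (P : Finset (EuclideanSpace ℝ (Fin d))) : ℕ :=
  sInf {N : ℕ | ∀ (x : EuclideanSpace ℝ (Fin d)) (r : ℝ), 0 < r →
    ∃ S : Finset (EuclideanSpace ℝ (Fin d)), S.card ≤ N ∧
      (P : Set (EuclideanSpace ℝ (Fin d))) ∩ Metric.closedBall x r ⊆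
        ⋃ c ∈ S, Metric.closedBall c (r / 2)}

/-- The doubling dimension of `P`: the number `l` such that `2 ^ l` is the doubling number. -/
def ddim {d : ℕ} (P : Finset (EuclideanSpace ℝ (Fin d))) : ℝ :=
  Real.logb 2 (doublingNumber P)

/-- The law of a Gaussian JL map: a `t × d` matrix with i.i.d. entries drawn from `N(0, 1/t)`,
as a measure on arrays of entries. -/
def gaussianJL (t d : ℕ) : Measure (Fin t → Fin d → ℝ) :=
  Measure.pi fun _ : Fin t => Measure.pi fun _ : Fin d => gaussianReal 0 (1 / (t : ℝ≥0))

/-- The points of `P` in `ℝᵈ`, as a family indexed by `P` itself. -/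
def points {d : ℕ} (P : Finset (EuclideanSpace ℝ (Fin d))) : P → EuclideanSpace ℝ (Fin d) :=
  fun p => p

/-- The image `G(P)`, as a family indexed by `P`: the point `p` goes to `G p`, with the
Euclidean norm on `ℝᵗ`. -/
def imagePoints {t d : ℕ} (G : Matrix (Fin t) (Fin d) ℝ)
    (P : Finset (EuclideanSpace ℝ (Fin d))) : P → EuclideanSpace ℝ (Fin t) :=
  fun p => WithLp.toLp 2 (G.mulVec (p : EuclideanSpace ℝ (Fin d)).ofLp)

section Problems

variable {V : Type*} [Fintype V] {F : Type*} [SeminormedAddCommGroup F]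

/-- The length of the pair `{p, q}` when the vertices are placed at the points `f p`, `f q`. -/
def edgeLength (f : V → F) : Sym2 V → ℝ :=
  Sym2.lift ⟨fun p q => ‖f p - f q‖, fun p q => norm_sub_rev (f p) (f q)⟩

/-- The total length of the edges of `M`. Matchings on the vertex set `V` are the subgraphs `M` of
the complete graph with `M.IsMatching`; they need not cover all vertices. -/
def matchingCost (f : V → F) (M : (⊤ : SimpleGraph V).Subgraph) : ℝ :=
  open Classical in ∑ e ∈ M.edgeSet.toFinset, edgeLength f e

/-- The optimum of maximum matching (a maximum over a finite nonempty family). -/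
def optMaxMatch (f : V → F) : ℝ :=
  ⨆ M : {M : (⊤ : SimpleGraph V).Subgraph // M.IsMatching}, matchingCost f M.1

/-- `M` is a `c`-approximate solution to maximum matching. -/
def IsApproxMaxMatch (c : ℝ) (f : V → F) (M : (⊤ : SimpleGraph V).Subgraph) : Prop :=
  M.IsMatching ∧ optMaxMatch f ≤ c * matchingCost f M

/-- A tour is given by its successor map, a permutation whose only cycle is all of `V`. -/
def IsTour (s : Equiv.Perm V) : Prop :=
  s.IsCycleOn Set.univ

/-- The length of the closed tour `v, s v, s (s v), …, v`. -/
def tourCost (f : V → F) (s : Equiv.Perm V) : ℝ :=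
  ∑ v, ‖f v - f (s v)‖

/-- The optimum of maximum TSP (a maximum over a finite nonempty family). -/
def optMaxTSP (f : V → F) : ℝ :=
  ⨆ s : {s : Equiv.Perm V // IsTour s}, tourCost f s.1

/-- `s` is a `c`-approximate solution to maximum TSP. -/
def IsApproxMaxTSP (c : ℝ) (f : V → F) (s : Equiv.Perm V) : Prop :=
  IsTour s ∧ optMaxTSP f ≤ c * tourCost f s

end Problems

/-- Every `c`-approximate solution for `G(P)` is a `c'`-approximate solution for `P`, both for
maximum matching and for maximum TSP. -/
def PreservesApprox {t d : ℕ} (G : Matrix (Fin t) (Fin d) ℝ)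
    (P : Finset (EuclideanSpace ℝ (Fin d))) (c c' : ℝ) : Prop :=
  (∀ M : (⊤ : SimpleGraph P).Subgraph,
    IsApproxMaxMatch c (imagePoints G P) M → IsApproxMaxMatch c' (points P) M) ∧
  (∀ s : Equiv.Perm P,
    IsApproxMaxTSP c (imagePoints G P) s → IsApproxMaxTSP c' (points P) s)

end MaxReduction

end

/-! The optimum shrinks little for a simple reason: an optimal solution of `P` is fixed before `G`
is drawn, so a first-moment bound on the deficits `(‖x‖ - ‖Gx‖)₊` of its edges suffices.

The opposite bound must hold for all solutions at once, with no union bound over them. Errors are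
therefore charged to vertices: `‖Gp - Gq‖ ≤ (1 + s)‖p - q‖ + W p + W q`. A vertex lies on at most
one matching edge or meets a tour twice, so every solution has total error at most `∑ W` or `2 ∑ W`.
By averaging over solutions, some center `c ∈ P` has `∑ ‖p - c‖` at most twice the matching optimum
and at most the tour optimum, so it is enough that `∑ W` is a small multiple of `∑ ‖p - c‖` in
expectation (`exists_expansion_weights`).

For the weights, each `q` is rounded to `π q` with error about `2⁻ᵏ‖q - c‖`, using nets at the
dyadic distances from `c`. If `p` is the farther of the two points, either `q` is so close to `c`
that `c` can replace it, or `π q` is one of `(k + 1) 2 ^ (l k)` points. The Gaussian tail `exp (-s²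
t / 2)` beats this count once `s² t ≥ 8 l (k + 1)`. The vector `q - π q` is a single one per point,
so its mean length is enough. Part 2 and the `(1 + ε)` claim use `s = ε / 20` and `2ᵏ` of order `1 /
ε`; arbitrary `κ` uses `s = 2ʲ` for all `j` simultaneously. -/

namespace MaxReduction

/-! ### Gaussian moments: mean excess and mean deficit of a projected length -/

/-- A linear form of a vector with i.i.d. centred Gaussian entries is Gaussian. -/
theorem map_sum_mul_pi_gaussianReal {ι : Type*} [Fintype ι] (v : ℝ≥0) (u : ι → ℝ) :
    (Measure.pi fun _ : ι => gaussianReal 0 v).map (fun x => ∑ j, x j * u j) =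
      gaussianReal 0 (v * ∑ j, ‖u j‖₊ ^ 2) := by
  have hm : Measurable fun x : ι → ℝ => ∑ j, x j * u j := by fun_prop
  have : IsProbabilityMeasure
      ((Measure.pi fun _ : ι => gaussianReal 0 v).map (fun x => ∑ j, x j * u j)) :=
    Measure.isProbabilityMeasure_map hm.aemeasurable
  apply Measure.ext_of_charFun
  funext a
  rw [charFun_apply_real, integral_map hm.aemeasurable (by fun_prop)]
  have h1 : ∀ x : ι → ℝ, Complex.exp (a * ((∑ j, x j * u j : ℝ) : ℂ) * Complex.I) =
      ∏ j, Complex.exp (((a * u j : ℝ) : ℂ) * (x j : ℂ) * Complex.I) := by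
    intro x
    rw [← Complex.exp_sum]
    congr 1
    push_cast
    rw [Finset.mul_sum, Finset.sum_mul]
    exact Finset.sum_congr rfl fun j _ => by ring
  simp_rw [h1]
  rw [integral_fintype_prod_eq_prod (𝕜 := ℂ)
    (f := fun j (y : ℝ) => Complex.exp (((a * u j : ℝ) : ℂ) * (y : ℂ) * Complex.I))]
  simp_rw [← charFun_apply_real, charFun_gaussianReal, ← Complex.exp_sum]
  congr 1
  simp only [Complex.ofReal_zero, mul_zero, zero_mul, zero_sub]
  push_cast
  rw [Finset.mul_sum, Finset.sum_mul, Finset.sum_div, ← Finset.sum_neg_distrib]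
  refine Finset.sum_congr rfl fun j _ => ?_
  have : ((‖u j‖ : ℝ) : ℂ) ^ 2 = (u j : ℂ) ^ 2 := by
    rw [← Complex.ofReal_pow, ← Complex.ofReal_pow, Real.norm_eq_abs, sq_abs]
  rw [this]
  ring

theorem integral_exp_mul_sq_gaussianReal (v : ℝ≥0) (θ : ℝ) (h : 2 * θ * v < 1) :
    ∫ x, Real.exp (θ * x ^ 2) ∂gaussianReal 0 v = (√(1 - 2 * θ * v))⁻¹ := by
  -- Variance zero does occur: for `x = 0`, and for `t = 0`, where `1 / t` is `0`.
  by_cases hv : v = 0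
  · simp [hv]
  have hv' : (0 : ℝ) < v := by positivity
  rw [integral_gaussianReal_eq_integral_smul hv]
  have h1 : ∀ x : ℝ, gaussianPDFReal 0 v x • Real.exp (θ * x ^ 2) =
      (√(2 * Real.pi * v))⁻¹ * Real.exp (-((1 - 2 * θ * v) / (2 * v)) * x ^ 2) := by
    intro x
    rw [gaussianPDFReal_def, smul_eq_mul, mul_assoc, ← Real.exp_add]
    congr 2
    field_simp
    ring
  simp_rw [h1]
  rw [integral_const_mul, integral_gaussian, ← Real.sqrt_inv, ← Real.sqrt_inv,
    ← Real.sqrt_mul (by positivity)]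
  congr 1
  have : (1 - 2 * θ * v) ≠ 0 := by linarith
  have := Real.pi_pos
  field_simp

/-- The linear map given by a matrix, between Euclidean spaces. -/
def image {t d : ℕ} (G : Matrix (Fin t) (Fin d) ℝ) (x : EuclideanSpace ℝ (Fin d)) :
    EuclideanSpace ℝ (Fin t) :=
  WithLp.toLp 2 (G.mulVec x.ofLp)

theorem image_sub {t d : ℕ} (G : Matrix (Fin t) (Fin d) ℝ) (x y : EuclideanSpace ℝ (Fin d)) :
    image G (x - y) = image G x - image G y := by
  simp [image, Matrix.mulVec_sub]

theorem image_zero {t d : ℕ} (G : Matrix (Fin t) (Fin d) ℝ) : image G 0 = 0 := by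
  simp [image]

theorem norm_image_sq {t d : ℕ} (G : Fin t → Fin d → ℝ) (x : EuclideanSpace ℝ (Fin d)) :
    ‖image (Matrix.of G) x‖ ^ 2 = ∑ i, (∑ j, G i j * x j) ^ 2 := by
  rw [EuclideanSpace.norm_sq_eq]
  simp [image, Matrix.mulVec, dotProduct]

@[fun_prop]
theorem measurable_norm_image {t d : ℕ} (x : EuclideanSpace ℝ (Fin d)) :
    Measurable fun G : Fin t → Fin d → ℝ => ‖image (Matrix.of G) x‖ := by
  have : (fun G : Fin t → Fin d → ℝ => ‖image (Matrix.of G) x‖) =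
      fun G => √(∑ i, (∑ j, G i j * x j) ^ 2) := by
    funext G
    rw [← norm_image_sq, Real.sqrt_sq (norm_nonneg _)]
  rw [this]
  fun_prop

instance isProbabilityMeasure_gaussianJL (t d : ℕ) : IsProbabilityMeasure (gaussianJL t d) := by
  unfold gaussianJL
  infer_instance

/-- The moment generating function of `‖G x‖ ^ 2`. -/
theorem integral_exp_mul_norm_image_sq {t d : ℕ} (x : EuclideanSpace ℝ (Fin d)) (θ : ℝ)
    (h : 2 * θ * (‖x‖ ^ 2 / t) < 1) :
    ∫ G, Real.exp (θ * ‖image (Matrix.of G) x‖ ^ 2) ∂gaussianJL t d =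
      (√(1 - 2 * θ * (‖x‖ ^ 2 / t)))⁻¹ ^ t := by
  simp_rw [norm_image_sq, Finset.mul_sum, Real.exp_sum]
  unfold gaussianJL
  rw [integral_fintype_prod_eq_prod (𝕜 := ℝ)
    (f := fun _ (g : Fin d → ℝ) => Real.exp (θ * (∑ j, g j * x j) ^ 2))]
  have hv : (((1 / (t : ℝ≥0)) * ∑ j, ‖x j‖₊ ^ 2 : ℝ≥0) : ℝ) = ‖x‖ ^ 2 / t := by
    rw [EuclideanSpace.norm_sq_eq]
    push_cast
    ring
  have h1 : ∫ g : Fin d → ℝ, Real.exp (θ * (∑ j, g j * x j) ^ 2)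
      ∂(Measure.pi fun _ : Fin d => gaussianReal 0 (1 / (t : ℝ≥0))) =
      (√(1 - 2 * θ * (‖x‖ ^ 2 / t)))⁻¹ := by
    rw [← hv] at h ⊢
    rw [← integral_exp_mul_sq_gaussianReal _ _ h, ← map_sum_mul_pi_gaussianReal,
      integral_map (by fun_prop : Measurable _).aemeasurable (by fun_prop)]
  rw [h1]
  simp

theorem lintegral_exp_mul_norm_image_sq {t d : ℕ} (x : EuclideanSpace ℝ (Fin d)) (θ : ℝ)
    (h : 2 * θ * (‖x‖ ^ 2 / t) < 1) :
    ∫⁻ G, ENNReal.ofReal (Real.exp (θ * ‖image (Matrix.of G) x‖ ^ 2)) ∂gaussianJL t d =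
      ENNReal.ofReal ((√(1 - 2 * θ * (‖x‖ ^ 2 / t)))⁻¹ ^ t) := by
  have h0 : 0 < (√(1 - 2 * θ * (‖x‖ ^ 2 / t)))⁻¹ ^ t := by
    have : 0 < 1 - 2 * θ * (‖x‖ ^ 2 / t) := by linarith
    positivity
  rw [← integral_exp_mul_norm_image_sq x θ h] at h0 ⊢
  rw [ofReal_integral_eq_lintegral_ofReal]
  -- A nonzero Bochner integral already certifies integrability.
  · exact not_imp_comm.1 integral_undef h0.ne'
  · exact Filter.Eventually.of_forall fun _ => (Real.exp_pos _).le

/-- The part of `‖G x‖` exceeding `(1 + s) ‖x‖` is small in expectation. -/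
theorem lintegral_norm_image_sub_le {t d : ℕ} (ht : 0 < t) {s : ℝ} (hs : 0 < s)
    (x : EuclideanSpace ℝ (Fin d)) :
    ∫⁻ G, ENNReal.ofReal (‖image (Matrix.of G) x‖ - (1 + s) * ‖x‖) ∂gaussianJL t d ≤
      ENNReal.ofReal ((1 + s) / (s * t) * Real.exp (-(s ^ 2 * t / 2)) * ‖x‖) := by
  by_cases hx : x = 0
  · simp [hx, image_zero]
  have hρ : 0 < ‖x‖ := norm_pos_iff.2 hx
  have ht' : (0 : ℝ) < t := by exact_mod_cast ht
  set ρ := ‖x‖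
  set a := 1 + s with ha
  have ha1 : 1 < a := by linarith
  -- The optimal Chernoff exponent: `1 - 2β = a⁻²`, so the moment generating function equals `aᵗ`.
  set β := (1 - (a ^ 2)⁻¹) / 2 with hβ
  have hβ0 : 0 < β := by
    have : (a ^ 2)⁻¹ < 1 := inv_lt_one_of_one_lt₀ (by nlinarith)
    rw [hβ]; linarith
  set θ := β * t / ρ ^ 2 with hθ
  -- Chosen so that `y - aρ ≤ A exp (θ y²)`: linearize `y² - a²ρ²` at `y = aρ`, then use `z ≤ exp
  -- z`.
  set A := ρ / (2 * a * (β * t)) * Real.exp (-(β * t * a ^ 2)) with hA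
  have hA0 : 0 ≤ A := by positivity
  have key : ∀ G : Fin t → Fin d → ℝ, ENNReal.ofReal (‖image (Matrix.of G) x‖ - a * ρ) ≤
      ENNReal.ofReal A * ENNReal.ofReal (Real.exp (θ * ‖image (Matrix.of G) x‖ ^ 2)) := by
    intro G
    rw [← ENNReal.ofReal_mul hA0]
    apply ENNReal.ofReal_le_ofReal
    set y := ‖image (Matrix.of G) x‖
    have hy : 0 ≤ y := norm_nonneg _
    have h1 : A * Real.exp (θ * y ^ 2) =
        ρ / (2 * a * (β * t)) * Real.exp (β * t * ((y / ρ) ^ 2 - a ^ 2)) := by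
      rw [hA, mul_assoc, ← Real.exp_add]
      congr 2
      rw [hθ]
      field_simp
      ring
    rw [h1]
    have h2 : β * t * ((y / ρ) ^ 2 - a ^ 2) ≤ Real.exp (β * t * ((y / ρ) ^ 2 - a ^ 2)) := by
      linarith [Real.add_one_le_exp (β * t * ((y / ρ) ^ 2 - a ^ 2))]
    have h3 : ρ / (2 * a * (β * t)) * (β * t * ((y / ρ) ^ 2 - a ^ 2)) =
        (y - a * ρ) + (y - a * ρ) ^ 2 / (2 * a * ρ) := by
      field_simp
      ring
    have h4 : 0 ≤ (y - a * ρ) ^ 2 / (2 * a * ρ) := by positivity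
    calc y - a * ρ ≤ ρ / (2 * a * (β * t)) * (β * t * ((y / ρ) ^ 2 - a ^ 2)) := by linarith
      _ ≤ _ := by gcongr
  have hval : 2 * θ * (ρ ^ 2 / t) = 1 - (a ^ 2)⁻¹ := by
    rw [hθ, hβ]
    field_simp
  refine (lintegral_mono key).trans ?_
  rw [lintegral_const_mul' _ _ ENNReal.ofReal_ne_top,
    lintegral_exp_mul_norm_image_sq x θ (by rw [hval]; have : 0 < (a ^ 2)⁻¹ := by positivity
                                            linarith), hval, ← ENNReal.ofReal_mul hA0]
  apply ENNReal.ofReal_le_ofReal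
  have h5 : (√(1 - (1 - (a ^ 2)⁻¹)))⁻¹ = a := by
    rw [sub_sub_cancel, Real.sqrt_inv, inv_inv, Real.sqrt_sq (by linarith)]
  rw [h5, hA]
  have h6 : a ^ t ≤ Real.exp (s * t) := by
    rw [mul_comm, Real.exp_nat_mul]
    gcongr
    linarith [Real.add_one_le_exp s]
  have h7 : Real.exp (-(β * t * a ^ 2)) * a ^ t ≤ Real.exp (-(s ^ 2 * t / 2)) := by
    calc _ ≤ Real.exp (-(β * t * a ^ 2)) * Real.exp (s * t) := by gcongr
      _ = Real.exp (-(s ^ 2 * t / 2)) := by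
        rw [← Real.exp_add]
        congr 1
        rw [hβ]
        field_simp
        rw [ha]
        ring
  have h8 : ρ / (2 * a * (β * t)) ≤ a / (s * t) * ρ := by
    have : 2 * a * (β * t) = (s * t / a) * (2 + s) := by
      rw [hβ]
      field_simp
      rw [ha]
      ring
    have h9 : ρ / (s * t / a * (2 + s)) = a / (s * t) * ρ / (2 + s) := by field_simp
    rw [this, h9]
    exact div_le_self (by positivity) (by linarith)
  calc _ = ρ / (2 * a * (β * t)) * (Real.exp (-(β * t * a ^ 2)) * a ^ t) := by ring
    _ ≤ a / (s * t) * ρ * Real.exp (-(s ^ 2 * t / 2)) := by gcongr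
    _ = _ := by ring

/-- The part of `‖x‖` exceeding `‖G x‖` is small in expectation. -/
theorem lintegral_sub_norm_image_le {t d : ℕ} {δ : ℝ} (hδ : 0 < δ) (hδ1 : δ ≤ 1)
    (ht : 2 / δ ^ 2 ≤ t) (x : EuclideanSpace ℝ (Fin d)) :
    ∫⁻ G, ENNReal.ofReal (‖x‖ - ‖image (Matrix.of G) x‖) ∂gaussianJL t d ≤
      ENNReal.ofReal (2 * δ * ‖x‖) := by
  by_cases hx : x = 0
  · simp [hx, image_zero]
  have hρ : 0 < ‖x‖ := norm_pos_iff.2 hx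
  have ht' : (0 : ℝ) < t := lt_of_lt_of_le (by positivity) ht
  set ρ := ‖x‖
  -- For `y ≤ ρ`, `ρ - y ≤ ρ(1 - (y/ρ)²) = δρ + ρ(1 - δ - (y/ρ)²)`. The last term is bounded by an
  -- exponential with this `θ`.
  set θ := -(δ * t / 2) / ρ ^ 2 with hθ
  set A := ρ * (2 / (δ * t)) * Real.exp (δ * t / 2 * (1 - δ)) with hA
  have hA0 : 0 ≤ A := by positivity
  have key : ∀ G : Fin t → Fin d → ℝ, ENNReal.ofReal (ρ - ‖image (Matrix.of G) x‖) ≤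
      ENNReal.ofReal (δ * ρ) +
      ENNReal.ofReal A * ENNReal.ofReal (Real.exp (θ * ‖image (Matrix.of G) x‖ ^ 2)) := by
    intro G
    rw [← ENNReal.ofReal_mul hA0, ← ENNReal.ofReal_add (by positivity) (by positivity)]
    apply ENNReal.ofReal_le_ofReal
    set y := ‖image (Matrix.of G) x‖
    have hy : 0 ≤ y := norm_nonneg _
    have h1 : A * Real.exp (θ * y ^ 2) =
        ρ * (2 / (δ * t)) * Real.exp (δ * t / 2 * (1 - δ - (y / ρ) ^ 2)) := by
      rw [hA, mul_assoc, ← Real.exp_add]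
      congr 2
      rw [hθ]
      field_simp
      ring
    rw [h1]
    have h2 := Real.add_one_le_exp (δ * t / 2 * (1 - δ - (y / ρ) ^ 2))
    have h4 : ρ * (2 / (δ * t)) * (δ * t / 2 * (1 - δ - (y / ρ) ^ 2)) =
        ρ * (1 - (y / ρ) ^ 2) - δ * ρ := by
      field_simp
      ring
    have h6 : 0 ≤ Real.exp (δ * t / 2 * (1 - δ - (y / ρ) ^ 2)) := (Real.exp_pos _).le
    rcases le_total ρ y with h | h
    · have : 0 ≤ ρ * (2 / (δ * t)) * Real.exp (δ * t / 2 * (1 - δ - (y / ρ) ^ 2)) := by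
        positivity
      nlinarith
    · have h5 : (y / ρ) ^ 2 ≤ y / ρ := by
        have : y / ρ ≤ 1 := (div_le_one hρ).2 h
        have : 0 ≤ y / ρ := by positivity
        nlinarith
      have h7 : ρ * (1 - y / ρ) = ρ - y := by field_simp
      calc ρ - y = ρ * (1 - y / ρ) := h7.symm
        _ ≤ ρ * (1 - (y / ρ) ^ 2) := by gcongr
        _ = δ * ρ + ρ * (2 / (δ * t)) * (δ * t / 2 * (1 - δ - (y / ρ) ^ 2)) := by
          rw [h4]; ring
        _ ≤ _ := by gcongr; linarith
  have hval : 2 * θ * (ρ ^ 2 / t) = -δ := by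
    rw [hθ]
    field_simp
  refine (lintegral_mono key).trans ?_
  rw [lintegral_add_left measurable_const, lintegral_const, measure_univ, mul_one,
    lintegral_const_mul' _ _ ENNReal.ofReal_ne_top,
    lintegral_exp_mul_norm_image_sq x θ (by rw [hval]; linarith), hval, ← ENNReal.ofReal_mul hA0,
    ← ENNReal.ofReal_add (by positivity) (by positivity)]
  apply ENNReal.ofReal_le_ofReal
  rw [sub_neg_eq_add, hA]
  -- After squaring this rests on `(1 - δ + δ²)(1 + δ) = 1 + δ³ ≥ 1`.
  have h1 : Real.exp (δ * (1 - δ) / 2) ≤ √(1 + δ) := by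
    apply Real.le_sqrt_of_sq_le
    rw [← Real.exp_nat_mul]
    have h2 : ((2 : ℕ) : ℝ) * (δ * (1 - δ) / 2) = -(-(δ * (1 - δ))) := by push_cast; ring
    rw [h2, Real.exp_neg]
    have h3 := Real.add_one_le_exp (-(δ * (1 - δ)))
    have h4 : 0 < -(δ * (1 - δ)) + 1 := by nlinarith
    calc _ ≤ (-(δ * (1 - δ)) + 1)⁻¹ := by gcongr
      _ ≤ 1 + δ := by
        rw [inv_le_iff_one_le_mul₀ h4]
        nlinarith [pow_pos hδ 3]
  have h2 : Real.exp (δ * t / 2 * (1 - δ)) * (√(1 + δ))⁻¹ ^ t ≤ 1 := by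
    have h3 : δ * t / 2 * (1 - δ) = t * (δ * (1 - δ) / 2) := by ring
    rw [h3, Real.exp_nat_mul, inv_pow, ← div_eq_mul_inv]
    apply div_le_one_of_le₀ _ (by positivity)
    gcongr
  have h3 : 2 / (δ * t) ≤ δ := by
    rw [div_le_iff₀ (by positivity)] at ht ⊢
    linarith
  calc _ = δ * ρ + ρ * (2 / (δ * t)) *
        (Real.exp (δ * t / 2 * (1 - δ)) * (√(1 + δ))⁻¹ ^ t) := by ring
    _ ≤ δ * ρ + ρ * δ * 1 := by gcongr
    _ = _ := by ring

/-- The excess bound at `s = 1`. The crude factor 4 is harmless, since it only multiplies rounding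
errors. -/
theorem lintegral_norm_image_le {t d : ℕ} (ht : 0 < t) (x : EuclideanSpace ℝ (Fin d)) :
    ∫⁻ G, ENNReal.ofReal ‖image (Matrix.of G) x‖ ∂gaussianJL t d ≤
      ENNReal.ofReal (4 * ‖x‖) := by
  have ht' : (1 : ℝ) ≤ t := by exact_mod_cast ht
  have key : ∀ G : Fin t → Fin d → ℝ, ENNReal.ofReal ‖image (Matrix.of G) x‖ ≤
      ENNReal.ofReal (2 * ‖x‖) +
        ENNReal.ofReal (‖image (Matrix.of G) x‖ - (1 + 1) * ‖x‖) := by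
    intro G
    refine le_trans (ENNReal.ofReal_le_ofReal ?_) ENNReal.ofReal_add_le
    linarith
  refine (lintegral_mono key).trans ?_
  rw [lintegral_add_left measurable_const, lintegral_const, measure_univ, mul_one]
  refine (add_le_add_right (lintegral_norm_image_sub_le ht one_pos x) _).trans ?_
  rw [← ENNReal.ofReal_add (by positivity) (by positivity)]
  apply ENNReal.ofReal_le_ofReal
  have h1 : Real.exp (-(1 ^ 2 * (t : ℝ) / 2)) ≤ 1 := Real.exp_le_one_iff.2 (by linarith)
  have h2 : (1 + 1) / (1 * (t : ℝ)) ≤ 2 := by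
    rw [div_le_iff₀ (by positivity)]
    linarith
  calc _ ≤ 2 * ‖x‖ + 2 * 1 * ‖x‖ := by gcongr
    _ = _ := by ring

end MaxReduction

/-! ### Covers of doubling sets and rounding towards a center -/

namespace MaxReduction

variable {d : ℕ}

theorem doublingNumber_spec (P : Finset (EuclideanSpace ℝ (Fin d)))
    (x : EuclideanSpace ℝ (Fin d)) (r : ℝ) (hr : 0 < r) :
    ∃ S : Finset (EuclideanSpace ℝ (Fin d)), S.card ≤ doublingNumber P ∧
      (P : Set (EuclideanSpace ℝ (Fin d))) ∩ Metric.closedBall x r ⊆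
        ⋃ c ∈ S, Metric.closedBall c (r / 2) := by
  have hne : {N : ℕ | ∀ (x : EuclideanSpace ℝ (Fin d)) (r : ℝ), 0 < r →
    ∃ S : Finset (EuclideanSpace ℝ (Fin d)), S.card ≤ N ∧
      (P : Set (EuclideanSpace ℝ (Fin d))) ∩ Metric.closedBall x r ⊆
        ⋃ c ∈ S, Metric.closedBall c (r / 2)}.Nonempty := by
    refine ⟨P.card, fun x r hr => ⟨P, le_rfl, fun p hp => ?_⟩⟩
    simp only [Set.mem_iUnion]
    exact ⟨p, hp.1, Metric.mem_closedBall_self (by positivity)⟩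
  exact Nat.sInf_mem hne x r hr

theorem doublingNumber_le_two_pow {P : Finset (EuclideanSpace ℝ (Fin d))} {l : ℕ}
    (h : ddim P ≤ l) : doublingNumber P ≤ 2 ^ l := by
  -- The empty set has doubling number 0, where the logarithm takes its default value 0.
  rcases Nat.eq_zero_or_pos (doublingNumber P) with h0 | h0
  · simp [h0]
  · rw [ddim, Real.logb_le_iff_le_rpow one_lt_two (by exact_mod_cast h0),
      Real.rpow_natCast] at h
    exact_mod_cast h

/-- Iterating the doubling property. -/
theorem exists_cover_two_pow (P : Finset (EuclideanSpace ℝ (Fin d))) (k : ℕ)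
    (x : EuclideanSpace ℝ (Fin d)) (r : ℝ) (hr : 0 < r) :
    ∃ S : Finset (EuclideanSpace ℝ (Fin d)), S.card ≤ doublingNumber P ^ k ∧
      (P : Set (EuclideanSpace ℝ (Fin d))) ∩ Metric.closedBall x r ⊆
        ⋃ c ∈ S, Metric.closedBall c (r / 2 ^ k) := by
  classical
  induction k with
  | zero => exact ⟨{x}, by simp, by simp⟩
  | succ k ih =>
    obtain ⟨S, hS, hcov⟩ := ih
    choose T hT hTcov using fun c => doublingNumber_spec P c (r / 2 ^ k) (by positivity)
    refine ⟨S.biUnion T, ?_, fun p hp => ?_⟩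
    · calc _ ≤ S.card * doublingNumber P := Finset.card_biUnion_le_card_mul _ _ _ fun c _ => hT c
        _ ≤ doublingNumber P ^ k * doublingNumber P := by gcongr
        _ = _ := (pow_succ _ _).symm
    · obtain ⟨c, hc, hpc⟩ := Set.mem_iUnion₂.1 (hcov hp)
      obtain ⟨y, hy, hpy⟩ := Set.mem_iUnion₂.1 (hTcov c ⟨hp.1, hpc⟩)
      refine Set.mem_iUnion₂.2 ⟨y, Finset.mem_biUnion.2 ⟨c, hc, hy⟩, ?_⟩
      rwa [pow_succ, ← div_div]

theorem card_le_one_of_doublingNumber_le_one {P : Finset (EuclideanSpace ℝ (Fin d))}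
    (h : doublingNumber P ≤ 1) : P.card ≤ 1 := by
  rw [Finset.card_le_one]
  intro p hp q hq
  by_contra hpq
  have hr : 0 < dist p q := dist_pos.2 hpq
  -- Two halvings are needed: a ball of radius `dist p q / 2` can contain both points, one of half
  -- that radius cannot.
  obtain ⟨S, hS, hcov⟩ := exists_cover_two_pow P 2 p (dist p q) hr
  have hS1 : S.card ≤ 1 := hS.trans (Nat.pow_le_one_iff two_ne_zero |>.2 h)
  obtain ⟨y, hy, hpy⟩ := Set.mem_iUnion₂.1
    (hcov ⟨hp, Metric.mem_closedBall_self hr.le⟩)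
  obtain ⟨z, hz, hqz⟩ := Set.mem_iUnion₂.1
    (hcov ⟨hq, by rw [Metric.mem_closedBall, dist_comm]⟩)
  rw [Finset.card_le_one.1 hS1 z hz y hy] at hqz
  rw [Metric.mem_closedBall] at hpy hqz
  have := dist_triangle_right p q y
  linarith

/-- A rounding map with error proportional to the distance to `c` that takes few values on points
of comparable distance to `c`. -/
theorem exists_rounding (P : Finset (EuclideanSpace ℝ (Fin d)))
    (c : EuclideanSpace ℝ (Fin d)) (k M : ℕ) (hM : 1 ≤ M)
    (hcov : ∀ (x : EuclideanSpace ℝ (Fin d)) (r : ℝ), 0 < r →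
      ∃ S : Finset (EuclideanSpace ℝ (Fin d)), S.card ≤ M ∧
        (P : Set (EuclideanSpace ℝ (Fin d))) ∩ Metric.closedBall x r ⊆
          ⋃ c ∈ S, Metric.closedBall c (r / 2 ^ k)) :
    ∃ π : EuclideanSpace ℝ (Fin d) → EuclideanSpace ℝ (Fin d),
      (∀ q ∈ P, ‖q - π q‖ ≤ 2 / 2 ^ k * ‖q - c‖) ∧
      ∀ p, ∃ T : Finset (EuclideanSpace ℝ (Fin d)), T.card ≤ (k + 1) * M ∧
        (∀ y ∈ T, ‖p - y‖ ≤ 4 * ‖p - c‖) ∧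
        ∀ q ∈ P, ‖p - c‖ ≤ 2 ^ k * ‖q - c‖ → ‖q - c‖ ≤ ‖p - c‖ → π q ∈ T := by
  classical
  -- `S i` is a net for the points `q` with `2 ^ i ≤ ‖q - c‖ < 2 ^ (i + 1)`.
  choose S hS hScov using fun i : ℤ => hcov c (2 ^ (i + 1)) (by positivity)
  set lvl : EuclideanSpace ℝ (Fin d) → ℤ := fun q => Int.log 2 ‖q - c‖ with hlvl
  have hlow : ∀ q, q ≠ c → (2 : ℝ) ^ lvl q ≤ ‖q - c‖ := fun q hq => by
    exact_mod_cast Int.zpow_log_le_self (b := 2) one_lt_two (norm_pos_iff.2 (sub_ne_zero.2 hq))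
  have hup : ∀ q, ‖q - c‖ < (2 : ℝ) ^ (lvl q + 1) := fun q => by
    exact_mod_cast Int.lt_zpow_succ_log_self (b := 2) one_lt_two ‖q - c‖
  -- The center has no dyadic level (`Int.log 2 0 = 0` is a default), so it is rounded to itself.
  have hex : ∀ q, ∃ y, q ∈ P → ((q = c → y = c) ∧
      (q ≠ c → y ∈ S (lvl q) ∧ ‖q - y‖ ≤ 2 ^ (lvl q + 1) / 2 ^ k)) := by
    intro q
    by_cases hqc : q = c
    · exact ⟨c, fun _ => ⟨fun _ => rfl, fun h => absurd hqc h⟩⟩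
    by_cases hq : q ∈ P
    · obtain ⟨y, hy, hqy⟩ := Set.mem_iUnion₂.1
        (hScov (lvl q) ⟨hq, by rw [Metric.mem_closedBall, dist_eq_norm]; exact (hup q).le⟩)
      rw [Metric.mem_closedBall, dist_eq_norm] at hqy
      exact ⟨y, fun _ => ⟨fun h => absurd h hqc, fun _ => ⟨hy, hqy⟩⟩⟩
    · exact ⟨q, fun h => absurd h hq⟩
  choose π hπ using hex
  have herr : ∀ q ∈ P, ‖q - π q‖ ≤ 2 / 2 ^ k * ‖q - c‖ := by
    intro q hq
    by_cases hqc : q = c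
    · rw [(hπ q hq).1 hqc, hqc]; simp
    · refine ((hπ q hq).2 hqc).2.trans ?_
      rw [zpow_add_one₀ two_ne_zero, mul_comm, mul_div_right_comm]
      gcongr
      exact hlow q hqc
  refine ⟨π, herr, fun p => ?_⟩
  -- `T` is the image of the relevant points, not the whole union of nets: each element is then `π
  -- q` with `q` no farther from `c` than `p`, which bounds its distance to `p`.
  set Q := P.filter fun q => ‖p - c‖ ≤ 2 ^ k * ‖q - c‖ ∧ ‖q - c‖ ≤ ‖p - c‖ with hQ
  refine ⟨Q.image π, ?_, ?_, fun q hq h1 h2 =>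
    Finset.mem_image_of_mem π (Finset.mem_filter.2 ⟨hq, h1, h2⟩)⟩
  · by_cases hpc : p = c
    · have : Q.image π ⊆ {c} := by
        intro y hy
        obtain ⟨q, hq, rfl⟩ := Finset.mem_image.1 hy
        obtain ⟨hqP, -, h2⟩ := Finset.mem_filter.1 hq
        rw [hpc, sub_self, norm_zero, norm_le_zero_iff, sub_eq_zero] at h2
        rw [(hπ q hqP).1 h2, Finset.mem_singleton]
      calc _ ≤ 1 := by simpa using Finset.card_le_card this
        _ ≤ _ := by nlinarith
    · have hp0 : 0 < ‖p - c‖ := norm_pos_iff.2 (sub_ne_zero.2 hpc)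
      -- Points of `Q` have levels between `lvl p - k` and `lvl p`, hence `k + 1` nets.
      have : Q.image π ⊆ (Finset.range (k + 1)).biUnion fun j => S (lvl p - j) := by
        intro y hy
        obtain ⟨q, hq, rfl⟩ := Finset.mem_image.1 hy
        obtain ⟨hqP, h1, h2⟩ := Finset.mem_filter.1 hq
        have hq0 : 0 < ‖q - c‖ := by
          by_contra hcon
          have : ‖q - c‖ = 0 := le_antisymm (not_lt.1 hcon) (norm_nonneg _)
          rw [this] at h1
          linarith
        have hqc : q ≠ c := sub_ne_zero.1 (norm_pos_iff.1 hq0)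
        have hle : lvl q ≤ lvl p := Int.log_mono_right hq0 h2
        have hge : lvl p < lvl q + 1 + k := by
          have : (2 : ℝ) ^ lvl p < 2 ^ (lvl q + 1 + k) := by
            calc (2 : ℝ) ^ lvl p ≤ ‖p - c‖ := hlow p hpc
              _ ≤ 2 ^ k * ‖q - c‖ := h1
              _ < 2 ^ k * 2 ^ (lvl q + 1) := by gcongr; exact hup q
              _ = _ := by rw [zpow_add₀ two_ne_zero (lvl q + 1), zpow_natCast, mul_comm]
          exact (zpow_lt_zpow_iff_right₀ one_lt_two).1 this
        refine Finset.mem_biUnion.2 ⟨(lvl p - lvl q).toNat, Finset.mem_range.2 (by omega), ?_⟩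
        have h3 : lvl p - ((lvl p - lvl q).toNat : ℤ) = lvl q := by omega
        rw [h3]
        exact ((hπ q hqP).2 hqc).1
      refine (Finset.card_le_card this).trans ?_
      simpa using Finset.card_biUnion_le_card_mul (Finset.range (k + 1))
        (fun j => S (lvl p - j)) M fun j _ => hS _
  · intro y hy
    obtain ⟨q, hq, rfl⟩ := Finset.mem_image.1 hy
    obtain ⟨hqP, -, h2⟩ := Finset.mem_filter.1 hq
    have h3 : p - π q = (p - c) - (q - c) + (q - π q) := by abel
    have h4 : (2 : ℝ) / 2 ^ k ≤ 2 := div_le_self (by norm_num) (one_le_pow₀ one_le_two)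
    have h5 := herr q hqP
    have h6 : 2 / 2 ^ k * ‖q - c‖ ≤ 2 * ‖p - c‖ := by gcongr
    calc ‖p - π q‖ ≤ ‖p - c‖ + ‖q - c‖ + ‖q - π q‖ := by
          rw [h3]
          exact (norm_add_le _ _).trans (add_le_add_left (norm_sub_le _ _) _)
      _ ≤ _ := by linarith

end MaxReduction

/-! ### Vertexwise error bounds and lower bounds on the optima -/

namespace MaxReduction

section Optima

variable {V : Type*} {F : Type*} [SeminormedAddCommGroup F]

theorem edgeLength_mk (f : V → F) (p q : V) : edgeLength f s(p, q) = ‖f p - f q‖ := rfl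

theorem edgeLength_nonneg (f : V → F) (e : Sym2 V) : 0 ≤ edgeLength f e := by
  induction e with
  | _ p q => exact norm_nonneg (f p - f q)

open Classical in
theorem sum_toFinset_edge {M : (⊤ : SimpleGraph V).Subgraph} {p q : V}
    (h : s(p, q) ∈ M.edgeSet) (g : V → ℝ) : ∑ v ∈ s(p, q).toFinset, g v = g p + g q := by
  have hne : p ≠ q := (SimpleGraph.Subgraph.mem_edgeSet.1 h).ne
  rw [Sym2.toFinset_mk_eq, Finset.sum_pair hne]

variable [Fintype V]

theorem matchingCost_nonneg (f : V → F) (M : (⊤ : SimpleGraph V).Subgraph) :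
    0 ≤ matchingCost f M :=
  Finset.sum_nonneg fun _ _ => edgeLength_nonneg _ _

theorem tourCost_nonneg (f : V → F) (s : Equiv.Perm V) : 0 ≤ tourCost f s :=
  Finset.sum_nonneg fun _ _ => norm_nonneg _

theorem matchingCost_le_optMaxMatch (f : V → F) {M : (⊤ : SimpleGraph V).Subgraph}
    (hM : M.IsMatching) : matchingCost f M ≤ optMaxMatch f :=
  le_ciSup (f := fun M : {M : (⊤ : SimpleGraph V).Subgraph // M.IsMatching} =>
    matchingCost f M.1) (Set.finite_range _).bddAbove ⟨M, hM⟩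

theorem tourCost_le_optMaxTSP (f : V → F) {s : Equiv.Perm V} (hs : IsTour s) :
    tourCost f s ≤ optMaxTSP f :=
  le_ciSup (f := fun s : {s : Equiv.Perm V // IsTour s} => tourCost f s.1)
    (Set.finite_range _).bddAbove ⟨s, hs⟩

theorem exists_matchingCost_eq (f : V → F) :
    ∃ M : (⊤ : SimpleGraph V).Subgraph, M.IsMatching ∧ matchingCost f M = optMaxMatch f := by
  have : Nonempty {M : (⊤ : SimpleGraph V).Subgraph // M.IsMatching} :=
    ⟨⟨⊥, fun v hv => absurd hv (by simp)⟩⟩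
  obtain ⟨M, hM⟩ := exists_eq_ciSup_of_finite
    (f := fun M : {M : (⊤ : SimpleGraph V).Subgraph // M.IsMatching} => matchingCost f M.1)
  exact ⟨M.1, M.2, hM⟩

variable (V) in
theorem exists_isTour : ∃ s : Equiv.Perm V, IsTour s := by
  classical
  obtain ⟨s, hs, -⟩ := Finset.exists_cycleOn (Finset.univ : Finset V)
  exact ⟨s, by simpa [IsTour] using hs⟩

theorem exists_tourCost_eq (f : V → F) :
    ∃ s : Equiv.Perm V, IsTour s ∧ tourCost f s = optMaxTSP f := by
  have : Nonempty {s : Equiv.Perm V // IsTour s} := nonempty_subtype.2 (exists_isTour V)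
  obtain ⟨s, hs⟩ := exists_eq_ciSup_of_finite
    (f := fun s : {s : Equiv.Perm V // IsTour s} => tourCost f s.1)
  exact ⟨s.1, s.2, hs⟩

open Classical in
/-- The edges of a matching partition its vertices. -/
theorem sum_edgeSet_toFinset {M : (⊤ : SimpleGraph V).Subgraph} (hM : M.IsMatching) (h : V → ℝ) :
    ∑ e ∈ M.edgeSet.toFinset, ∑ v ∈ e.toFinset, h v = ∑ v ∈ M.verts.toFinset, h v := by
  rw [← Finset.sum_biUnion]
  · refine Finset.sum_congr ?_ fun _ _ => rfl
    ext v
    simp only [Finset.mem_biUnion, Set.mem_toFinset, Sym2.mem_toFinset]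
    constructor
    · rintro ⟨e, he, hv⟩
      exact M.mem_verts_of_mem_edge he hv
    · intro hv
      obtain ⟨w, hw, -⟩ := hM hv
      exact ⟨s(v, w), hw, Sym2.mem_mk_left v w⟩
  · intro e he e' he' hne
    rw [Function.onFun, Finset.disjoint_left]
    intro v hv hv'
    rw [Sym2.mem_toFinset] at hv hv'
    obtain ⟨w, rfl⟩ := Sym2.mem_iff_exists.1 hv
    obtain ⟨w', rfl⟩ := Sym2.mem_iff_exists.1 hv'
    simp only [Set.coe_toFinset, SimpleGraph.Subgraph.mem_edgeSet] at he he'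
    exact hne (by rw [hM.eq_of_adj_left he he'])

/-- Matching costs are controlled by a vertexwise bound on the distortion of distances. -/
theorem matchingCost_le_of_norm_sub_le {F' : Type*} [SeminormedAddCommGroup F'] (f : V → F)
    (g : V → F') (L : ℝ) (W : V → ℝ) (hW : ∀ v, 0 ≤ W v)
    (h : ∀ p q, ‖g p - g q‖ ≤ L * ‖f p - f q‖ + (W p + W q))
    {M : (⊤ : SimpleGraph V).Subgraph} (hM : M.IsMatching) :
    matchingCost g M ≤ L * matchingCost f M + ∑ v, W v := by
  classical
  have h1 : matchingCost g M ≤ ∑ e ∈ M.edgeSet.toFinset,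
      (L * edgeLength f e + ∑ v ∈ e.toFinset, W v) := by
    unfold matchingCost
    refine (Finset.sum_le_sum (g := fun e => L * edgeLength f e + ∑ v ∈ e.toFinset, W v)
      fun e he => ?_).trans (le_of_eq ?_)
    · induction e with
      | _ p q =>
        rw [sum_toFinset_edge (by simpa using he)]
        exact h p q
    · congr!
  rw [Finset.sum_add_distrib, ← Finset.mul_sum, sum_edgeSet_toFinset hM] at h1
  refine h1.trans (add_le_add (le_of_eq ?_) ?_)
  · unfold matchingCost
    congr!
  · exact Finset.sum_le_sum_of_subset_of_nonneg (Finset.subset_univ _) fun v _ _ => hW v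

/-- Each vertex is charged once as a source and once as a successor, hence the factor 2. -/
theorem tourCost_le_of_norm_sub_le {F' : Type*} [SeminormedAddCommGroup F'] (f : V → F)
    (g : V → F') (L : ℝ) (W : V → ℝ)
    (h : ∀ p q, ‖g p - g q‖ ≤ L * ‖f p - f q‖ + (W p + W q)) (s : Equiv.Perm V) :
    tourCost g s ≤ L * tourCost f s + 2 * ∑ v, W v := by
  calc tourCost g s ≤ ∑ v, (L * ‖f v - f (s v)‖ + (W v + W (s v))) :=
        Finset.sum_le_sum fun v _ => h v (s v)
    _ = _ := by
      rw [Finset.sum_add_distrib, Finset.sum_add_distrib, ← Finset.mul_sum,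
        Equiv.sum_comp s W, tourCost]
      ring

/-- The matching of an involution. -/
theorem sum_norm_sub_involution_le (f : V → F) (σ : V → V) (hσ : Function.Involutive σ) :
    ∑ v, ‖f v - f (σ v)‖ ≤ 2 * optMaxMatch f := by
  classical
  let M : (⊤ : SimpleGraph V).Subgraph :=
    { verts := {v | σ v ≠ v}
      Adj := fun p q => σ p = q ∧ p ≠ q
      adj_sub := fun h => h.2
      edge_vert := fun {p q} h => by
        rw [Set.mem_ofPred_eq, h.1]
        exact h.2.symm
      symm := ⟨fun p q h => ⟨by rw [← h.1, hσ], h.2.symm⟩⟩ }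
  have hM : M.IsMatching := fun v hv => ⟨σ v, ⟨rfl, fun h => hv h.symm⟩, fun w hw => hw.1.symm⟩
  have h1 := sum_edgeSet_toFinset hM fun v => ‖f v - f (σ v)‖
  have h2 : ∑ v ∈ M.verts.toFinset, ‖f v - f (σ v)‖ = ∑ v, ‖f v - f (σ v)‖ := by
    refine Finset.sum_subset (Finset.subset_univ _) fun v _ hv => ?_
    have : σ v = v := by simpa [M] using hv
    simp [this]
  have h3 : ∑ e ∈ M.edgeSet.toFinset, ∑ v ∈ e.toFinset, ‖f v - f (σ v)‖ =
      2 * matchingCost f M := by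
    unfold matchingCost
    rw [Finset.mul_sum]
    refine (Finset.sum_congr rfl (g := fun e => 2 * edgeLength f e) fun e he => ?_).trans ?_
    · induction e with
      | _ p q =>
        have he' : s(p, q) ∈ M.edgeSet := by simpa using he
        have hpq : σ p = q := (SimpleGraph.Subgraph.mem_edgeSet.1 he').1
        have hqp : σ q = p := by rw [← hpq, hσ]
        rw [sum_toFinset_edge he', hpq, hqp, edgeLength_mk, norm_sub_rev (f q)]
        ring
    · congr!
  have h4 : 2 * matchingCost f M = ∑ v, ‖f v - f (σ v)‖ := by
    rw [← h2, ← h3, h1]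
    congr!
  linarith [matchingCost_le_optMaxMatch f hM]

/-- With `V` identified with `ℤ/n`, the `n` involutions `v ↦ k - v` realize every ordered pair
exactly once (`k = p + q`), and each costs at most twice the optimum. -/
theorem sum_sum_norm_sub_le_optMaxMatch (f : V → F) :
    ∑ p, ∑ q, ‖f p - f q‖ ≤ Fintype.card V * (2 * optMaxMatch f) := by
  classical
  rcases isEmpty_or_nonempty V with hV | hV
  · simp
  have : NeZero (Fintype.card V) := ⟨Fintype.card_ne_zero⟩
  let e : V ≃ ZMod (Fintype.card V) := Fintype.equivOfCardEq (ZMod.card _).symm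
  have h1 : ∑ k : ZMod (Fintype.card V), ∑ v, ‖f v - f (e.symm (k - e v))‖ =
      ∑ p, ∑ q, ‖f p - f q‖ := by
    rw [Finset.sum_comm]
    refine Finset.sum_congr rfl fun v _ => ?_
    exact Equiv.sum_comp ((Equiv.subRight (e v)).trans e.symm) fun q => ‖f v - f q‖
  rw [← h1]
  refine (Finset.sum_le_card_nsmul _ _ (2 * optMaxMatch f) fun k _ =>
    sum_norm_sub_involution_le f (fun v => e.symm (k - e v)) fun v => by simp).trans ?_
  simp [ZMod.card]

/-- All conjugates of one tour are tours. Summing their costs over the symmetric group gives each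
pair of distinct vertices the same weight, by double transitivity. -/
theorem sum_sum_norm_sub_le_optMaxTSP (f : V → F) :
    ∑ p, ∑ q, ‖f p - f q‖ ≤ Fintype.card V * optMaxTSP f := by
  classical
  obtain ⟨s, hs⟩ := exists_isTour V
  rcases subsingleton_or_nontrivial V with hV | hV
  · have h0 : ∀ p q, ‖f p - f q‖ = 0 := fun p q => by simp [Subsingleton.elim p q]
    have := (tourCost_nonneg f s).trans (tourCost_le_optMaxTSP f hs)
    simp only [h0, Finset.sum_const_zero]
    positivity
  have hsne : ∀ v, v ≠ s v := fun v =>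
    (hs.apply_ne Set.nontrivial_univ (Set.mem_univ v)).symm
  set T : V → V → ℝ := fun i j => ∑ σ : Equiv.Perm V, ‖f (σ i) - f (σ j)‖ with hT
  have hinv : ∀ (τ : Equiv.Perm V) i j, T (τ i) (τ j) = T i j := fun τ i j =>
    Equiv.sum_comp (Equiv.mulRight τ) fun σ : Equiv.Perm V => ‖f (σ i) - f (σ j)‖
  have hconst : ∀ i j i' j', i ≠ j → i' ≠ j' → T i j = T i' j' := by
    intro i j i' j' hij hij'
    have h1 : Equiv.swap i i' j ≠ i' := fun h => hij <| by
      exact ((Equiv.swap i i').injective (h.trans (Equiv.swap_apply_left i i').symm)).symm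
    rw [← hinv (Equiv.swap (Equiv.swap i i' j) j' * Equiv.swap i i') i j]
    simp only [Equiv.Perm.mul_apply, Equiv.swap_apply_left]
    rw [Equiv.swap_apply_of_ne_of_ne h1.symm hij']
  have htour : ∑ v, T v (s v) ≤ (Fintype.card (Equiv.Perm V)) * optMaxTSP f := by
    rw [hT, Finset.sum_comm]
    refine (Finset.sum_le_card_nsmul _ _ (optMaxTSP f) fun σ _ => ?_).trans (by simp)
    have hσ : IsTour (σ * s * σ⁻¹) := by
      have := hs.conj (g := σ)
      rwa [Set.image_univ_of_surjective σ.surjective] at this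
    refine le_trans (le_of_eq ?_) (tourCost_le_optMaxTSP f hσ)
    rw [tourCost, ← Equiv.sum_comp σ fun v => ‖f v - f ((σ * s * σ⁻¹) v)‖]
    simp
  have hsum : ∑ p, ∑ q, T p q =
      (Fintype.card (Equiv.Perm V)) * ∑ p, ∑ q, ‖f p - f q‖ := by
    have h1 : ∀ p, ∑ q, T p q = ∑ σ : Equiv.Perm V, ∑ q, ‖f (σ p) - f q‖ := fun p => by
      rw [hT, Finset.sum_comm]
      exact Finset.sum_congr rfl fun σ _ => Equiv.sum_comp σ fun q => ‖f (σ p) - f q‖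
    simp_rw [h1]
    rw [Finset.sum_comm]
    simp_rw [fun σ : Equiv.Perm V => Equiv.sum_comp σ fun p => ∑ q, ‖f p - f q‖]
    simp
  have hT0 : ∀ p q, T p q ≤ T p (s p) := by
    intro p q
    by_cases hpq : p = q
    · subst hpq
      simp only [hT, sub_self, norm_zero, Finset.sum_const_zero]
      exact Finset.sum_nonneg fun _ _ => norm_nonneg _
    · exact (hconst p q p (s p) hpq (hsne p)).le
  have h2 : ∑ p, ∑ q, T p q ≤ Fintype.card V * ∑ v, T v (s v) := by
    rw [Finset.mul_sum]
    refine Finset.sum_le_sum fun p _ => ?_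
    refine (Finset.sum_le_card_nsmul _ _ _ fun q _ => hT0 p q).trans (by simp)
  have hpos : (0 : ℝ) < Fintype.card (Equiv.Perm V) := by exact_mod_cast Fintype.card_pos
  rw [hsum] at h2
  refine le_of_mul_le_mul_left (h2.trans ?_) hpos
  calc _ ≤ (Fintype.card V : ℝ) * ((Fintype.card (Equiv.Perm V)) * optMaxTSP f) := by gcongr
    _ = _ := by ring

/-- The distances to a suitable vertex sum to at most twice the value of either optimum. -/
theorem exists_center [Nonempty V] (f : V → F) :
    ∃ c, ∑ q, ‖f q - f c‖ ≤ 2 * optMaxMatch f ∧ ∑ q, ‖f q - f c‖ ≤ optMaxTSP f := by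
  -- The minimizer is no worse than the average over `V`, and serves both optima at once.
  obtain ⟨c, -, hc⟩ := Finset.exists_min_image Finset.univ (fun c => ∑ q, ‖f q - f c‖)
    Finset.univ_nonempty
  have hpos : (0 : ℝ) < Fintype.card V := by exact_mod_cast Fintype.card_pos
  have h1 : Fintype.card V * ∑ q, ‖f q - f c‖ ≤ ∑ p, ∑ q, ‖f p - f q‖ := by
    rw [Finset.sum_comm]
    refine le_trans (by simp) (Finset.card_nsmul_le_sum _ _ _ hc)
  exact ⟨c, le_of_mul_le_mul_left (h1.trans (sum_sum_norm_sub_le_optMaxMatch f)) hpos,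
    le_of_mul_le_mul_left (h1.trans (sum_sum_norm_sub_le_optMaxTSP f)) hpos⟩

end Optima

end MaxReduction

/-! ### Random vertex weights and first-moment estimates -/

namespace MaxReduction

variable {t d : ℕ}

theorem norm_imagePoints_sub (G : Matrix (Fin t) (Fin d) ℝ)
    (P : Finset (EuclideanSpace ℝ (Fin d))) (p q : P) :
    ‖imagePoints G P p - imagePoints G P q‖ =
      ‖image G ((p : EuclideanSpace ℝ (Fin d)) - q)‖ := by
  rw [image_sub]
  rfl

/-- The net count against the Gaussian tail: the 4 comes from `‖p - y‖ ≤ 4‖p - c‖`, the 1 from the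
excess of `p - c` itself. -/
theorem card_mul_exp_le {l k : ℕ} (hl : 1 ≤ l) :
    ((k + 1 : ℝ) * 2 ^ (l * k) * 4 + 1) * Real.exp (-(4 * l * (k + 1))) ≤ 1 / 2 ^ k := by
  have h1 : ((k : ℝ) + 1) ≤ 2 ^ k := by exact_mod_cast Nat.lt_two_pow_self (n := k)
  have h2 : (2 : ℝ) ^ (4 * l * (k + 1)) ≤ Real.exp (4 * l * (k + 1)) := by
    have h3 : (4 : ℝ) * l * (k + 1) = ((4 * l * (k + 1) : ℕ) : ℝ) * 1 := by push_cast; ring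
    rw [h3, Real.exp_nat_mul]
    gcongr
    linarith [Real.add_one_le_exp 1]
  have h4 : (1 : ℝ) ≤ 2 ^ k * 2 ^ (l * k) :=
    one_le_mul_of_one_le_of_one_le (one_le_pow₀ one_le_two) (one_le_pow₀ one_le_two)
  have h5 : 3 + 2 * k + l * k ≤ 4 * l * (k + 1) := by nlinarith [Nat.mul_le_mul_right k hl]
  rw [Real.exp_neg, ← div_eq_mul_inv, div_le_div_iff₀ (Real.exp_pos _) (by positivity), one_mul]
  calc ((k + 1 : ℝ) * 2 ^ (l * k) * 4 + 1) * 2 ^ k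
      ≤ (2 ^ k * 2 ^ (l * k) * 4 + 4 * (2 ^ k * 2 ^ (l * k))) * 2 ^ k := by
        gcongr
        linarith
    _ = 2 ^ (3 + 2 * k + l * k) := by ring
    _ ≤ 2 ^ (4 * l * (k + 1)) := pow_le_pow_right₀ one_le_two h5
    _ ≤ _ := h2

/-- Distances between the points of a doubling set expand by a factor of more than `1 + s` only up
to an error that splits into contributions of the two points, with small total expectation. -/
theorem exists_expansion_weights (ht : 0 < t) {s : ℝ} (hs : 0 < s) (hst : 1 ≤ s * t) {l k : ℕ}
    (hl : 1 ≤ l) (hk : 8 * (l : ℝ) * (k + 1) ≤ s ^ 2 * t)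
    (P : Finset (EuclideanSpace ℝ (Fin d))) (hP : doublingNumber P ≤ 2 ^ l)
    (c : EuclideanSpace ℝ (Fin d)) :
    ∃ W : (Fin t → Fin d → ℝ) → P → ℝ, (∀ p, Measurable fun G => W G p) ∧
      (∀ G p, 0 ≤ W G p) ∧
      (∀ G p q, ‖imagePoints (Matrix.of G) P p - imagePoints (Matrix.of G) P q‖ ≤
        (1 + s) * ‖points P p - points P q‖ + (W G p + W G q)) ∧
      ∫⁻ G, ENNReal.ofReal (∑ p, W G p) ∂gaussianJL t d ≤
        ENNReal.ofReal (16 * (1 + s) / 2 ^ k * ∑ p : P, ‖points P p - c‖) := by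
  obtain ⟨π, hπ, hT⟩ := exists_rounding P c k (2 ^ (l * k)) Nat.one_le_two_pow fun x r hr => by
    obtain ⟨S, hS, hcov⟩ := exists_cover_two_pow P k x r hr
    refine ⟨S, hS.trans ?_, hcov⟩
    rw [pow_mul]
    exact Nat.pow_le_pow_left hP k
  choose T hTcard hTdist hTmem using hT
  set L := 1 + s with hL
  have hL1 : 1 < L := by linarith
  set τ := L / (s * t) * Real.exp (-(s ^ 2 * t / 2)) with hτ
  have hτ0 : 0 ≤ τ := by positivity
  let ex : (Fin t → Fin d → ℝ) → EuclideanSpace ℝ (Fin d) → ℝ :=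
    fun G x => max (‖image (Matrix.of G) x‖ - L * ‖x‖) 0
  have hex0 : ∀ G x, 0 ≤ ex G x := fun G x => le_max_right _ _
  have hex : ∀ G x, ‖image (Matrix.of G) x‖ ≤ L * ‖x‖ + ex G x := fun G x => by
    linarith [le_max_left (‖image (Matrix.of G) x‖ - L * ‖x‖) 0]
  have hexm : ∀ x, Measurable fun G => ex G x := fun x => by
    simp only [ex]
    fun_prop
  have hexI : ∀ x, ∫⁻ G, ENNReal.ofReal (ex G x) ∂gaussianJL t d ≤
      ENNReal.ofReal (τ * ‖x‖) := fun x => by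
    simp only [ex, ENNReal.ofReal_max, ENNReal.ofReal_zero]
    simpa using lintegral_norm_image_sub_le ht hs x
  let r : EuclideanSpace ℝ (Fin d) → ℝ := fun p => ‖p - c‖
  have hr0 : ∀ p, 0 ≤ r p := fun p => norm_nonneg _
  -- A point pays for the deterministic rounding loss, for the excess towards all its candidate
  -- targets (a sum dominating the maximum over `q`), for the excess towards `c`, and for the image
  -- of its own rounding error.
  let W : (Fin t → Fin d → ℝ) → EuclideanSpace ℝ (Fin d) → ℝ := fun G p =>
    2 * L / 2 ^ k * r p + (∑ y ∈ T p, ex G (p - y) + (ex G (p - c) +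
      ‖image (Matrix.of G) (p - π p)‖))
  have hW0 : ∀ G p, 0 ≤ W G p := fun G p =>
    add_nonneg (mul_nonneg (by positivity) (hr0 p)) (add_nonneg
      (Finset.sum_nonneg fun _ _ => hex0 _ _) (add_nonneg (hex0 _ _) (norm_nonneg _)))
  have hWm : ∀ p, Measurable fun G => W G p := fun p => by
    simp only [W]
    fun_prop
  have hpair : ∀ G, ∀ p ∈ P, ∀ q ∈ P, r q ≤ r p →
      ‖image (Matrix.of G) (p - q)‖ ≤ L * ‖p - q‖ + (W G p + W G q) := by
    intro G p hp q hq hqp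
    have hZ0 : ∀ p, 0 ≤ ∑ y ∈ T p, ex G (p - y) := fun p =>
      Finset.sum_nonneg fun _ _ => hex0 _ _
    have hZp := hZ0 p
    have hZq := hZ0 q
    have hYp := hex0 G (p - c)
    have hYq := hex0 G (q - c)
    have hRp := norm_nonneg (image (Matrix.of G) (p - π p))
    have hRq := norm_nonneg (image (Matrix.of G) (q - π q))
    have hap : 0 ≤ 2 * L / 2 ^ k * r p := mul_nonneg (by positivity) (hr0 p)
    have haq : 0 ≤ 2 * L / 2 ^ k * r q := mul_nonneg (by positivity) (hr0 q)
    -- Comparable distances: route through `π q`. Otherwise route through `c`, where the detour `2 L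
    -- r q` is at most `2 L r p / 2 ^ k`.
    rcases le_or_gt (r p) (2 ^ k * r q) with h | h
    · have hmem := hTmem p q hq h hqp
      have h1 : ex G (p - π q) ≤ ∑ y ∈ T p, ex G (p - y) :=
        Finset.single_le_sum (f := fun y => ex G (p - y)) (fun _ _ => hex0 _ _) hmem
      have h2 : ‖image (Matrix.of G) (p - q)‖ ≤
          ‖image (Matrix.of G) (p - π q)‖ + ‖image (Matrix.of G) (q - π q)‖ := by
        rw [← sub_sub_sub_cancel_right p q (π q), image_sub]
        exact norm_sub_le _ _
      have h3 : ‖p - π q‖ ≤ ‖p - q‖ + 2 / 2 ^ k * r q :=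
        (norm_sub_le_norm_sub_add_norm_sub p q (π q)).trans (add_le_add_right (hπ q hq) _)
      have h4 := hex G (p - π q)
      have h5 : L * ‖p - π q‖ ≤ L * ‖p - q‖ + 2 * L / 2 ^ k * r q := by
        calc _ ≤ L * (‖p - q‖ + 2 / 2 ^ k * r q) := by gcongr
          _ = _ := by ring
      simp only [W]
      linarith
    · have h2 : ‖image (Matrix.of G) (p - q)‖ ≤
          ‖image (Matrix.of G) (p - c)‖ + ‖image (Matrix.of G) (q - c)‖ := by
        rw [← sub_sub_sub_cancel_right p q c, image_sub]
        exact norm_sub_le _ _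
      have h3 : r p ≤ ‖p - q‖ + r q := norm_sub_le_norm_sub_add_norm_sub p q c
      have h4 := hex G (p - c)
      have h5 := hex G (q - c)
      have h6 : 2 * L * r q ≤ 2 * L / 2 ^ k * r p := by
        rw [div_mul_eq_mul_div, le_div_iff₀ (by positivity)]
        calc _ = 2 * L * (2 ^ k * r q) := by ring
          _ ≤ _ := by gcongr
      have h7 : L * r p ≤ L * (‖p - q‖ + r q) := by gcongr
      have h8 : ‖p - c‖ = r p := rfl
      have h9 : ‖q - c‖ = r q := rfl
      rw [h8] at h4
      rw [h9] at h5
      simp only [W]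
      linarith
  refine ⟨fun G p => W G p, fun p => hWm p, fun G p => hW0 G p, fun G p q => ?_, ?_⟩
  · rw [norm_imagePoints_sub]
    rcases le_total (r q) (r p) with h | h
    · exact hpair G p p.2 q q.2 h
    · rw [← neg_sub (q : EuclideanSpace ℝ (Fin d)), ← zero_sub, image_sub, image_zero, zero_sub,
        norm_neg, norm_sub_rev, add_comm (W G p)]
      exact hpair G q q.2 p p.2 h
  have hbound : ∀ p ∈ P, ∫⁻ G, ENNReal.ofReal (W G p) ∂gaussianJL t d ≤
      ENNReal.ofReal (16 * L / 2 ^ k * r p) := by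
    intro p hp
    have hsum : ∫⁻ G, ENNReal.ofReal (∑ y ∈ T p, ex G (p - y)) ∂gaussianJL t d ≤
        ENNReal.ofReal ((k + 1 : ℝ) * 2 ^ (l * k) * (τ * (4 * r p))) := by
      simp_rw [ENNReal.ofReal_sum_of_nonneg fun y _ => hex0 _ (p - y)]
      rw [lintegral_finsetSum _ fun y _ => (hexm _).ennreal_ofReal]
      have h1 : ∀ y ∈ T p, ∫⁻ G, ENNReal.ofReal (ex G (p - y)) ∂gaussianJL t d ≤
          ENNReal.ofReal (τ * (4 * r p)) := fun y hy =>
        (hexI _).trans (ENNReal.ofReal_le_ofReal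
          (mul_le_mul_of_nonneg_left (hTdist p y hy) hτ0))
      refine (Finset.sum_le_card_nsmul _ _ _ h1).trans ?_
      rw [nsmul_eq_mul, ← ENNReal.ofReal_natCast,
        ← ENNReal.ofReal_mul (Nat.cast_nonneg _)]
      apply ENNReal.ofReal_le_ofReal
      have h2 : ((T p).card : ℝ) ≤ (k + 1 : ℝ) * 2 ^ (l * k) := by exact_mod_cast hTcard p
      exact mul_le_mul_of_nonneg_right h2 (mul_nonneg hτ0 (by linarith [hr0 p]))
    have hround : ∫⁻ G, ENNReal.ofReal ‖image (Matrix.of G) (p - π p)‖ ∂gaussianJL t d ≤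
        ENNReal.ofReal (4 * (2 / 2 ^ k * r p)) :=
      (lintegral_norm_image_le ht _).trans (ENNReal.ofReal_le_ofReal
        (mul_le_mul_of_nonneg_left (hπ p hp) (by norm_num)))
    have hτr : 0 ≤ τ * r p := mul_nonneg hτ0 (hr0 p)
    have hcr : 0 ≤ 2 * L / 2 ^ k * r p := mul_nonneg (by positivity) (hr0 p)
    have hpr : 0 ≤ 4 * (2 / 2 ^ k * r p) :=
      mul_nonneg (by norm_num) (mul_nonneg (by positivity) (hr0 p))
    have hkr : 0 ≤ (k + 1 : ℝ) * 2 ^ (l * k) * (τ * (4 * r p)) := by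
      have : 0 ≤ r p := hr0 p
      positivity
    calc ∫⁻ G, ENNReal.ofReal (W G p) ∂gaussianJL t d
        ≤ ∫⁻ G, (ENNReal.ofReal (2 * L / 2 ^ k * r p) +
            (ENNReal.ofReal (∑ y ∈ T p, ex G (p - y)) + (ENNReal.ofReal (ex G (p - c)) +
              ENNReal.ofReal ‖image (Matrix.of G) (p - π p)‖))) ∂gaussianJL t d := by
          refine lintegral_mono fun G => ENNReal.ofReal_add_le.trans (add_le_add_right ?_ _)
          exact ENNReal.ofReal_add_le.trans (add_le_add_right ENNReal.ofReal_add_le _)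
      _ ≤ ENNReal.ofReal (2 * L / 2 ^ k * r p) +
            (ENNReal.ofReal ((k + 1 : ℝ) * 2 ^ (l * k) * (τ * (4 * r p))) +
              (ENNReal.ofReal (τ * r p) + ENNReal.ofReal (4 * (2 / 2 ^ k * r p)))) := by
          rw [lintegral_add_left measurable_const, lintegral_const, measure_univ, mul_one,
            lintegral_add_left
              (Finset.measurable_sum _ fun y _ => hexm (p - y)).ennreal_ofReal,
            lintegral_add_left (hexm _).ennreal_ofReal]
          gcongr
          exact hexI _
      _ = ENNReal.ofReal (2 * L / 2 ^ k * r p + ((k + 1 : ℝ) * 2 ^ (l * k) * (τ * (4 * r p)) +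
            (τ * r p + 4 * (2 / 2 ^ k * r p)))) := by
          rw [ENNReal.ofReal_add hcr (by positivity), ENNReal.ofReal_add hkr (by positivity),
            ENNReal.ofReal_add hτr hpr]
      _ ≤ _ := by
          apply ENNReal.ofReal_le_ofReal
          have h1 : τ ≤ L * Real.exp (-(4 * l * (k + 1))) := by
            rw [hτ]
            have : L / (s * t) ≤ L := div_le_self (by linarith) hst
            gcongr
            linarith
          have h2 : ((k + 1 : ℝ) * 2 ^ (l * k) * 4 + 1) * τ ≤ L / 2 ^ k := by
            calc _ ≤ ((k + 1 : ℝ) * 2 ^ (l * k) * 4 + 1) *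
                  (L * Real.exp (-(4 * l * (k + 1)))) := by gcongr
              _ = L * (((k + 1 : ℝ) * 2 ^ (l * k) * 4 + 1) *
                  Real.exp (-(4 * l * (k + 1)))) := by ring
              _ ≤ L * (1 / 2 ^ k) := by gcongr; exact card_mul_exp_le hl
              _ = _ := by ring
          have h3 : (8 : ℝ) / 2 ^ k ≤ 13 * L / 2 ^ k := by
            gcongr
            linarith
          calc _ = (2 * L / 2 ^ k + ((k + 1 : ℝ) * 2 ^ (l * k) * 4 + 1) * τ + 8 / 2 ^ k) *
                r p := by ring
            _ ≤ (2 * L / 2 ^ k + L / 2 ^ k + 13 * L / 2 ^ k) * r p := by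
              have : 0 ≤ r p := hr0 p
              gcongr
            _ = _ := by ring
  simp_rw [ENNReal.ofReal_sum_of_nonneg fun (p : P) (_ : p ∈ Finset.univ) => hW0 _ (p : _)]
  rw [lintegral_finsetSum _ fun (p : P) _ => (hWm p).ennreal_ofReal, Finset.mul_sum,
    ENNReal.ofReal_sum_of_nonneg fun (p : P) _ => mul_nonneg (by positivity) (norm_nonneg _)]
  exact Finset.sum_le_sum fun p _ => hbound p p.2

/-- Markov's inequality, with a bound relative to a possibly vanishing scale `D`. -/
theorem measure_mul_lt_le {Ω : Type*} [MeasurableSpace Ω] (μ : Measure Ω) {X : Ω → ℝ}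
    (hX : AEMeasurable X μ) {a b D : ℝ} (hb : 0 < b) (hD : 0 ≤ D)
    (h : ∫⁻ ω, ENNReal.ofReal (X ω) ∂μ ≤ ENNReal.ofReal (a * D)) :
    μ {ω | b * D < X ω} ≤ ENNReal.ofReal (a / b) := by
  rcases hD.eq_or_lt with rfl | hD
  · rw [mul_zero, ENNReal.ofReal_zero, nonpos_iff_eq_zero,
      lintegral_eq_zero_iff' hX.ennreal_ofReal] at h
    refine le_of_eq_of_le ?_ zero_le
    refine measure_mono_null (fun ω (hω : b * 0 < X ω) => ?_) h
    simpa using hω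
  · have h1 := meas_ge_le_lintegral_div hX.ennreal_ofReal
      (ENNReal.ofReal_pos.2 (mul_pos hb hD)).ne' ENNReal.ofReal_ne_top
    refine (measure_mono fun ω (hω : b * D < X ω) => ?_).trans (h1.trans ?_)
    · exact ENNReal.ofReal_le_ofReal hω.le
    · refine (ENNReal.div_le_div_right h _).trans ?_
      rw [← ENNReal.ofReal_div_of_pos (mul_pos hb hD), mul_div_mul_right _ _ hD.ne']

/-- Distances between points of `P` are expanded by `G` by a factor of at most `L`, up to an error
that is charged to the points and amounts to at most `g` times the total distance to `c`. -/
def ExpandsAtMost (G : Matrix (Fin t) (Fin d) ℝ) (P : Finset (EuclideanSpace ℝ (Fin d)))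
    (c : EuclideanSpace ℝ (Fin d)) (L g : ℝ) : Prop :=
  ∃ W : P → ℝ, (∀ p, 0 ≤ W p) ∧
    (∀ p q, ‖imagePoints G P p - imagePoints G P q‖ ≤
      L * ‖points P p - points P q‖ + (W p + W q)) ∧
    ∑ p, W p ≤ g * ∑ p : P, ‖points P p - c‖

/-- Markov's inequality for the total weight. Measurability of this event is not needed: it lies
inside one defined by `∑ W`. -/
theorem measure_not_expandsAtMost_le (ht : 0 < t) {s : ℝ} (hs : 0 < s) (hst : 1 ≤ s * t)
    {l k : ℕ} (hl : 1 ≤ l) (hk : 8 * (l : ℝ) * (k + 1) ≤ s ^ 2 * t)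
    (P : Finset (EuclideanSpace ℝ (Fin d))) (hP : doublingNumber P ≤ 2 ^ l)
    (c : EuclideanSpace ℝ (Fin d)) {g : ℝ} (hg : 0 < g) :
    gaussianJL t d {G | ¬ExpandsAtMost (Matrix.of G) P c (1 + s) g} ≤
      ENNReal.ofReal (16 * (1 + s) / 2 ^ k / g) := by
  obtain ⟨W, hWm, hW0, hW, hWI⟩ := exists_expansion_weights ht hs hst hl hk P hP c
  refine (measure_mono fun G hG => ?_).trans (measure_mul_lt_le (gaussianJL t d)
    (Finset.measurable_sum _ fun p _ => hWm p).aemeasurable hg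
    (Finset.sum_nonneg fun _ _ => norm_nonneg _) hWI)
  by_contra hcon
  exact hG ⟨W G, hW0 G, hW G, not_lt.1 hcon⟩

/-- A fixed family of vectors does not shrink much in total. -/
theorem measure_sum_norm_image_lt_le {ι : Type*} (A : Finset ι)
    (u : ι → EuclideanSpace ℝ (Fin d)) {δ μ : ℝ} (hδ : 0 < δ) (hδ1 : δ ≤ 1) (hμ : 0 < μ)
    (ht : 2 / δ ^ 2 ≤ t) :
    gaussianJL t d {G | ∑ i ∈ A, ‖image (Matrix.of G) (u i)‖ < (1 - μ) * ∑ i ∈ A, ‖u i‖} ≤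
      ENNReal.ofReal (2 * δ / μ) := by
  have hI : ∫⁻ G, ENNReal.ofReal (∑ i ∈ A, max (‖u i‖ - ‖image (Matrix.of G) (u i)‖) 0)
      ∂gaussianJL t d ≤ ENNReal.ofReal (2 * δ * ∑ i ∈ A, ‖u i‖) := by
    simp_rw [ENNReal.ofReal_sum_of_nonneg fun i (_ : i ∈ A) =>
      le_max_right (‖u i‖ - ‖image (Matrix.of _) (u i)‖) 0]
    rw [lintegral_finsetSum _ fun i _ => by fun_prop, Finset.mul_sum,
      ENNReal.ofReal_sum_of_nonneg fun i _ => by positivity]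
    refine Finset.sum_le_sum fun i _ => ?_
    simp only [ENNReal.ofReal_max, ENNReal.ofReal_zero]
    simpa using lintegral_sub_norm_image_le hδ hδ1 ht (u i)
  refine (measure_mono fun G hG => ?_).trans (measure_mul_lt_le (gaussianJL t d)
    (Finset.measurable_sum _ fun i _ => by fun_prop).aemeasurable hμ (Finset.sum_nonneg fun _ _ => norm_nonneg _) hI)
  have h1 : ∑ i ∈ A, (‖u i‖ - ‖image (Matrix.of G) (u i)‖) ≤
      ∑ i ∈ A, max (‖u i‖ - ‖image (Matrix.of G) (u i)‖) 0 :=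
    Finset.sum_le_sum fun i _ => le_max_left _ _
  rw [Finset.sum_sub_distrib] at h1
  have h2 : ∑ i ∈ A, ‖image (Matrix.of G) (u i)‖ < (1 - μ) * ∑ i ∈ A, ‖u i‖ := hG
  change μ * ∑ i ∈ A, ‖u i‖ < _
  linarith

end MaxReduction

/-! ### From expansion bounds to approximation guarantees -/

namespace MaxReduction

variable {t d : ℕ}

theorem ExpandsAtMost.matchingCost_le {G : Matrix (Fin t) (Fin d) ℝ}
    {P : Finset (EuclideanSpace ℝ (Fin d))} {c : EuclideanSpace ℝ (Fin d)} {L g : ℝ}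
    (h : ExpandsAtMost G P c L g) (hg : 0 ≤ g)
    (hc : ∑ p : P, ‖points P p - c‖ ≤ 2 * optMaxMatch (points P))
    {M : (⊤ : SimpleGraph P).Subgraph} (hM : M.IsMatching) :
    matchingCost (imagePoints G P) M ≤
      L * matchingCost (points P) M + 2 * g * optMaxMatch (points P) := by
  obtain ⟨W, hW0, hW, hWsum⟩ := h
  have h1 := matchingCost_le_of_norm_sub_le (points P) (imagePoints G P) L W hW0 hW hM
  have h2 := mul_le_mul_of_nonneg_left hc hg
  linarith

theorem ExpandsAtMost.tourCost_le {G : Matrix (Fin t) (Fin d) ℝ}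
    {P : Finset (EuclideanSpace ℝ (Fin d))} {c : EuclideanSpace ℝ (Fin d)} {L g : ℝ}
    (h : ExpandsAtMost G P c L g) (hg : 0 ≤ g)
    (hc : ∑ p : P, ‖points P p - c‖ ≤ optMaxTSP (points P)) (s : Equiv.Perm P) :
    tourCost (imagePoints G P) s ≤
      L * tourCost (points P) s + 2 * g * optMaxTSP (points P) := by
  obtain ⟨W, hW0, hW, hWsum⟩ := h
  have h1 := tourCost_le_of_norm_sub_le (points P) (imagePoints G P) L W hW s
  have h2 := mul_le_mul_of_nonneg_left hc hg
  linarith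

theorem optMaxMatch_nonneg {V : Type*} [Fintype V] {F : Type*} [SeminormedAddCommGroup F]
    (f : V → F) : 0 ≤ optMaxMatch f := by
  obtain ⟨M, -, hM⟩ := exists_matchingCost_eq f
  exact hM ▸ matchingCost_nonneg f M

theorem optMaxTSP_nonneg {V : Type*} [Fintype V] {F : Type*} [SeminormedAddCommGroup F]
    (f : V → F) : 0 ≤ optMaxTSP f := by
  obtain ⟨s, -, hs⟩ := exists_tourCost_eq f
  exact hs ▸ tourCost_nonneg f s

/-- Only one optimal matching, chosen independently of `G`, has to survive the projection. -/
theorem measure_optMaxMatch_lt_le (P : Finset (EuclideanSpace ℝ (Fin d))) {δ μ : ℝ} (hδ : 0 < δ)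
    (hδ1 : δ ≤ 1) (hμ : 0 < μ) (ht : 2 / δ ^ 2 ≤ t) :
    gaussianJL t d {G | optMaxMatch (imagePoints (Matrix.of G) P) <
      (1 - μ) * optMaxMatch (points P)} ≤ ENNReal.ofReal (2 * δ / μ) := by
  classical
  obtain ⟨M, hM, hopt⟩ := exists_matchingCost_eq (points P)
  refine (measure_mono fun G hG => ?_).trans (measure_sum_norm_image_lt_le
    M.edgeSet.toFinset (fun e => points P (Quot.out e).1 - points P (Quot.out e).2)
    hδ hδ1 hμ ht)
  have hedge : ∀ {F : Type} [SeminormedAddCommGroup F] (f : P → F) (e : Sym2 P),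
      edgeLength f e = ‖f (Quot.out e).1 - f (Quot.out e).2‖ := by
    intro F _ f e
    conv_lhs => rw [← Quot.out_eq e]
    rfl
  have h1 : matchingCost (imagePoints (Matrix.of G) P) M = ∑ e ∈ M.edgeSet.toFinset,
      ‖image (Matrix.of G) (points P (Quot.out e).1 - points P (Quot.out e).2)‖ := by
    unfold matchingCost
    refine Finset.sum_congr (by congr!) fun e _ => ?_
    rw [hedge, norm_imagePoints_sub]
    rfl
  have h2 : optMaxMatch (points P) = ∑ e ∈ M.edgeSet.toFinset,
      ‖points P (Quot.out e).1 - points P (Quot.out e).2‖ := by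
    rw [← hopt]
    unfold matchingCost
    exact Finset.sum_congr (by congr!) fun e _ => hedge _ e
  rw [Set.mem_ofPred_eq, ← h1, ← h2]
  exact (matchingCost_le_optMaxMatch _ hM).trans_lt hG

theorem measure_optMaxTSP_lt_le (P : Finset (EuclideanSpace ℝ (Fin d))) {δ μ : ℝ} (hδ : 0 < δ)
    (hδ1 : δ ≤ 1) (hμ : 0 < μ) (ht : 2 / δ ^ 2 ≤ t) :
    gaussianJL t d {G | optMaxTSP (imagePoints (Matrix.of G) P) <
      (1 - μ) * optMaxTSP (points P)} ≤ ENNReal.ofReal (2 * δ / μ) := by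
  obtain ⟨s, hs, hopt⟩ := exists_tourCost_eq (points P)
  refine (measure_mono fun G hG => ?_).trans (measure_sum_norm_image_lt_le
    Finset.univ (fun p : P => points P p - points P (s p)) hδ hδ1 hμ ht)
  have h1 : tourCost (imagePoints (Matrix.of G) P) s =
      ∑ p : P, ‖image (Matrix.of G) (points P p - points P (s p))‖ := by
    exact Finset.sum_congr rfl fun p _ => norm_imagePoints_sub _ P p (s p)
  have h2 : optMaxTSP (points P) = ∑ p : P, ‖points P p - points P (s p)‖ := hopt.symm
  rw [Set.mem_ofPred_eq, ← h1, ← h2]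
  exact (tourCost_le_optMaxTSP _ hs).trans_lt hG

/-- Good approximations remain good when costs change by little. -/
theorem opt_le_of_approx_near_one {ε s γ a a' o o' : ℝ} (hε : 0 < ε) (hε1 : ε < 1)
    (ha : a ≤ o) (ha0 : 0 ≤ a) (hs : 0 ≤ s) (hsγ : s + γ ≤ ε / 10)
    (hup : a' ≤ (1 + s) * a + γ * o) (hlow : (1 - ε / 10) * o ≤ o') (happ : o' ≤ (1 + ε) * a') :
    o ≤ (1 + 2 * ε) * a := by
  have ho : 0 ≤ o := ha0.trans ha
  have h1 : a' ≤ a + ε / 10 * o := by nlinarith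
  have h2 : (1 - ε / 10) * o ≤ (1 + ε) * (a + ε / 10 * o) :=
    hlow.trans (happ.trans (by gcongr))
  have h3 : (1 - 3 * ε / 10) * o ≤ (1 + ε) * a := by nlinarith [mul_nonneg hε.le ho]
  -- Valid because `ε < 1`; this yields `C' = 2`.
  have h4 : (1 + ε) ≤ (1 - 3 * ε / 10) * (1 + 2 * ε) := by nlinarith
  have h5 : 0 < 1 - 3 * ε / 10 := by linarith
  refine le_of_mul_le_mul_left (h3.trans ?_) h5
  calc (1 + ε) * a ≤ (1 - 3 * ε / 10) * (1 + 2 * ε) * a := by gcongr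
    _ = _ := by ring

/-- The error `κ γ o` is absorbed into half of `o / 2`. The expansion `L` may be large; only `γ`
must be small compared with `1 / κ`, which is why large `s` are useful. -/
theorem opt_le_of_approx {κ L γ a a' o o' : ℝ} (hκ : 1 ≤ κ) (hγ : κ * γ ≤ 1 / 4) (ho : 0 ≤ o)
    (hup : a' ≤ L * a + γ * o) (hlow : o / 2 ≤ o') (happ : o' ≤ κ * a') :
    o ≤ 4 * κ * L * a := by
  have h1 : κ * a' ≤ κ * (L * a + γ * o) := by gcongr
  have h2 : κ * γ * o ≤ 1 / 4 * o := by gcongr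
  linarith

/-- The approximation guarantee obtained from a `κ`-approximate solution of the projected
problem. -/
noncomputable def approxFactor (κ : ℝ) : ℝ :=
  4 * κ * (1 + 2 ^ ⌈5120 * κ⌉₊)

/-- The deterministic part of the reduction. -/
theorem preservesApprox_of_expandsAtMost {G : Matrix (Fin t) (Fin d) ℝ}
    {P : Finset (EuclideanSpace ℝ (Fin d))} {c : EuclideanSpace ℝ (Fin d)} {ε g : ℝ}
    (hε : 0 < ε) (hε1 : ε < 1) (hg : 0 ≤ g) (hgε : 2 * g ≤ ε / 20)
    (hcM : ∑ p : P, ‖points P p - c‖ ≤ 2 * optMaxMatch (points P))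
    (hcT : ∑ p : P, ‖points P p - c‖ ≤ optMaxTSP (points P))
    (hsmall : ExpandsAtMost G P c (1 + ε / 20) g)
    (hlarge : ∀ j : ℕ, ExpandsAtMost G P c (1 + 2 ^ j) (640 / 2 ^ j))
    (hM : (1 - ε / 10) * optMaxMatch (points P) ≤ optMaxMatch (imagePoints G P))
    (hT : (1 - ε / 10) * optMaxTSP (points P) ≤ optMaxTSP (imagePoints G P)) :
    PreservesApprox G P (1 + ε) (1 + 2 * ε) ∧
      ∀ κ : ℝ, 1 ≤ κ → PreservesApprox G P κ (approxFactor κ) := by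
  have hM0 := optMaxMatch_nonneg (points P)
  have hT0 := optMaxTSP_nonneg (points P)
  refine ⟨⟨fun M hM' => ⟨hM'.1, ?_⟩, fun s hs => ⟨hs.1, ?_⟩⟩, fun κ hκ =>
    ⟨fun M hM' => ⟨hM'.1, ?_⟩, fun s hs => ⟨hs.1, ?_⟩⟩⟩
  · exact opt_le_of_approx_near_one hε hε1 (matchingCost_le_optMaxMatch _ hM'.1)
      (matchingCost_nonneg _ _) (by linarith) (by linarith)
      (hsmall.matchingCost_le hg hcM hM'.1) hM hM'.2
  · exact opt_le_of_approx_near_one hε hε1 (tourCost_le_optMaxTSP _ hs.1)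
      (tourCost_nonneg _ _) (by linarith) (by linarith) (hsmall.tourCost_le hg hcT s) hT hs.2
  all_goals
    -- Needed is `1280 κ / 2ʲ ≤ 1 / 4`, that is `2ʲ ≥ 5120 κ`; `j = ⌈5120 κ⌉₊` is a crude choice.
    have hγ : κ * (2 * (640 / 2 ^ ⌈5120 * κ⌉₊)) ≤ 1 / 4 := by
      have h1 : 5120 * κ ≤ 2 ^ ⌈5120 * κ⌉₊ :=
        (Nat.le_ceil _).trans (by exact_mod_cast Nat.lt_two_pow_self.le)
      have h2 : κ * (2 * (640 / 2 ^ ⌈5120 * κ⌉₊)) = 1280 * κ / 2 ^ ⌈5120 * κ⌉₊ := by ring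
      rw [h2, div_le_iff₀ (by positivity)]
      linarith
  · exact opt_le_of_approx hκ hγ hM0 ((hlarge _).matchingCost_le (by positivity) hcM hM'.1)
      (le_trans (by nlinarith) hM) hM'.2
  · exact opt_le_of_approx hκ hγ hT0 ((hlarge _).tourCost_le (by positivity) hcT s)
      (le_trans (by nlinarith) hT) hs.2

/-- One event must serve all `κ`. With `s = 2ʲ` and `k = 3j`, `3j + 1 ≤ 4ʲ` makes `t ≥ 8l` enough at
every scale, and the failure probabilities are at most `2⁻ʲ / 20`, with sum `1 / 10`. -/
theorem measure_exists_not_expandsAtMost_le {l : ℕ} (hl : 1 ≤ l) (ht : 8 * (l : ℝ) ≤ t)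
    (P : Finset (EuclideanSpace ℝ (Fin d))) (hP : doublingNumber P ≤ 2 ^ l)
    (c : EuclideanSpace ℝ (Fin d)) :
    gaussianJL t d {G | ∃ j : ℕ, ¬ExpandsAtMost (Matrix.of G) P c (1 + 2 ^ j) (640 / 2 ^ j)} ≤
      ENNReal.ofReal (1 / 10) := by
  have hl' : (1 : ℝ) ≤ l := by exact_mod_cast hl
  have ht1 : (1 : ℝ) ≤ t := by linarith
  have hj : ∀ j : ℕ, gaussianJL t d
      {G | ¬ExpandsAtMost (Matrix.of G) P c (1 + 2 ^ j) (640 / 2 ^ j)} ≤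
        ENNReal.ofReal (1 / 20 * (1 / 2) ^ j) := by
    intro j
    have hj1 : (1 : ℝ) ≤ 2 ^ j := one_le_pow₀ one_le_two
    have hj4 : (3 * j + 1 : ℝ) ≤ (2 ^ j) ^ 2 := by
      have h1 : 1 + (j : ℝ) * 3 ≤ (1 + 3) ^ j := one_add_mul_le_pow (by norm_num) j
      calc (3 * j + 1 : ℝ) = 1 + j * 3 := by ring
        _ ≤ (1 + 3) ^ j := h1
        _ = _ := by rw [← pow_mul, mul_comm j, pow_mul]; norm_num
    refine (measure_not_expandsAtMost_le (s := 2 ^ j) (k := 3 * j) (by exact_mod_cast ht1)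
      (by positivity) (one_le_mul_of_one_le_of_one_le hj1 ht1) hl ?_ P hP c
      (by positivity)).trans (ENNReal.ofReal_le_ofReal ?_)
    · push_cast
      calc 8 * (l : ℝ) * (3 * j + 1) ≤ t * (2 ^ j) ^ 2 := by gcongr
        _ = _ := mul_comm _ _
    · rw [one_div_pow, pow_mul']
      have h1 : 16 * (1 + (2 : ℝ) ^ j) / (2 ^ j) ^ 3 / (640 / 2 ^ j) =
          1 / 40 * (1 / 2 ^ j) * ((1 + 2 ^ j) / 2 ^ j) := by
        field_simp
        norm_num
      have h2 : (1 + (2 : ℝ) ^ j) / 2 ^ j ≤ 2 := by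
        rw [div_le_iff₀ (by positivity)]
        linarith
      rw [h1]
      calc _ ≤ 1 / 40 * (1 / (2 : ℝ) ^ j) * 2 := by gcongr
        _ = _ := by ring
  have hset : {G : Fin t → Fin d → ℝ |
      ∃ j : ℕ, ¬ExpandsAtMost (Matrix.of G) P c (1 + 2 ^ j) (640 / 2 ^ j)} =
      ⋃ j : ℕ, {G | ¬ExpandsAtMost (Matrix.of G) P c (1 + 2 ^ j) (640 / 2 ^ j)} := by
    ext G
    simp
  rw [hset]
  refine (measure_iUnion_le _).trans ((ENNReal.tsum_le_tsum hj).trans ?_)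
  rw [← ENNReal.ofReal_tsum_of_nonneg (fun j => by positivity)
    (summable_geometric_two.mul_left _), tsum_mul_left, tsum_geometric_two]
  apply ENNReal.ofReal_le_ofReal
  norm_num

/-- The bound `12800 / ε` is what `2 * (320 / 2 ^ k) ≤ ε / 20` requires; the logarithmic bound on
`k` produces the `log (2 / ε)` in the dimension. -/
theorem exists_two_pow_near {ε : ℝ} (hε : 0 < ε) (hε1 : ε < 1) :
    ∃ k : ℕ, 12800 / ε ≤ 2 ^ k ∧ (k + 1 : ℝ) ≤ 24 * Real.log (2 / ε) := by
  obtain ⟨n, hn, hn'⟩ := exists_nat_pow_near (x := 12800 / ε) (y := 2)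
    (by rw [le_div_iff₀ hε]; linarith) one_lt_two
  refine ⟨n + 1, hn'.le, ?_⟩
  have hlog2 : (0.6931471803 : ℝ) < Real.log 2 := Real.log_two_gt_d9
  have hle : Real.log 2 ≤ Real.log (2 / ε) := by
    apply Real.log_le_log two_pos
    rw [le_div_iff₀ hε]
    linarith
  have h1 : n * Real.log 2 ≤ 13 * Real.log 2 + Real.log (2 / ε) := by
    have h2 : (2 : ℝ) ^ n ≤ 2 ^ 13 * (2 / ε) := hn.trans (by
      rw [← mul_div_assoc]
      gcongr
      norm_num)
    have h3 := Real.log_le_log (by positivity) h2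
    rw [Real.log_mul (by positivity) (by positivity), Real.log_pow, Real.log_pow] at h3
    exact_mod_cast h3
  push_cast
  nlinarith

theorem ofReal_one_sub_le_measure {Ω : Type*} [MeasurableSpace Ω] (μ : Measure Ω)
    [IsProbabilityMeasure μ] {Q : Ω → Prop} {b : ℝ} (hb : 0 ≤ b)
    (h : μ {ω | ¬Q ω} ≤ ENNReal.ofReal b) : ENNReal.ofReal (1 - b) ≤ μ {ω | Q ω} := by
  rw [ENNReal.ofReal_sub _ hb, ENNReal.ofReal_one, tsub_le_iff_right]
  calc 1 = μ Set.univ := measure_univ.symm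
    _ ≤ μ ({ω | Q ω} ∪ {ω | ¬Q ω}) := measure_mono fun ω _ => em (Q ω)
    _ ≤ _ := (measure_union_le _ _).trans (add_le_add_right h _)

theorem matchingCost_of_subsingleton {V : Type*} [Fintype V] [Subsingleton V] {F : Type*}
    [SeminormedAddCommGroup F] (f : V → F) (M : (⊤ : SimpleGraph V).Subgraph) :
    matchingCost f M = 0 := by
  refine Finset.sum_eq_zero fun e _ => ?_
  induction e with
  | _ p q => rw [Subsingleton.elim p q, edgeLength_mk, sub_self, norm_zero]

theorem tourCost_of_subsingleton {V : Type*} [Fintype V] [Subsingleton V] {F : Type*}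
    [SeminormedAddCommGroup F] (f : V → F) (s : Equiv.Perm V) : tourCost f s = 0 :=
  Finset.sum_eq_zero fun v _ => by rw [Subsingleton.elim (s v) v, sub_self, norm_zero]

theorem preservesApprox_of_subsingleton (G : Matrix (Fin t) (Fin d) ℝ)
    (P : Finset (EuclideanSpace ℝ (Fin d))) [Subsingleton P] (c c' : ℝ) :
    PreservesApprox G P c c' := by
  obtain ⟨M₀, -, hM₀⟩ := exists_matchingCost_eq (points P)
  obtain ⟨s₀, -, hs₀⟩ := exists_tourCost_eq (points P)
  rw [matchingCost_of_subsingleton] at hM₀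
  rw [tourCost_of_subsingleton] at hs₀
  refine ⟨fun M hM => ⟨hM.1, ?_⟩, fun s hs => ⟨hs.1, ?_⟩⟩
  · rw [← hM₀, matchingCost_of_subsingleton, mul_zero]
  · rw [← hs₀, tourCost_of_subsingleton, mul_zero]

end MaxReduction

/-! ### The main theorem: constants and failure probabilities -/

open MaxReduction

theorem mainTheorem1 :
    ∃ (C C' : ℝ) (K : ℝ → ℝ), 0 < C ∧ 0 < C' ∧
      ∀ ε : ℝ, 0 < ε → ε < 1 →
      ∀ d l t : ℕ, C * (ε ^ 2)⁻¹ * (l : ℝ) * Real.log (2 / ε) ≤ (t : ℝ) →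
      ∀ P : Finset (EuclideanSpace ℝ (Fin d)), MaxReduction.ddim P ≤ (l : ℝ) →
        (2 / 3 : ℝ≥0∞) ≤ MaxReduction.gaussianJL t d
          {G | MaxReduction.PreservesApprox (Matrix.of G) P (1 + ε) (1 + C' * ε) ∧
            ∀ κ : ℝ, 1 ≤ κ → MaxReduction.PreservesApprox (Matrix.of G) P κ (K κ)} ∧
        (9 / 10 : ℝ≥0∞) ≤ MaxReduction.gaussianJL t d
          {G | ∀ M : (⊤ : SimpleGraph P).Subgraph, M.IsMatching →
            MaxReduction.matchingCost (MaxReduction.imagePoints (Matrix.of G) P) M ≤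
              MaxReduction.matchingCost (MaxReduction.points P) M +
                ε * MaxReduction.optMaxMatch (MaxReduction.points P)} := by
  -- The size of `C` is dictated by the deficit estimate, which needs `ε² t ≥ 2 · 400²`.
  refine ⟨1000000, 2, approxFactor, by norm_num, by norm_num, ?_⟩
  intro ε hε hε1 d l t ht P hdd
  have hP := doublingNumber_le_two_pow hdd
  have h23 : (2 / 3 : ℝ≥0∞) = ENNReal.ofReal (2 / 3) := by
    rw [ENNReal.ofReal_div_of_pos (by norm_num)]
    simp
  have h910 : (9 / 10 : ℝ≥0∞) = ENNReal.ofReal (9 / 10) := by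
    rw [ENNReal.ofReal_div_of_pos (by norm_num)]
    simp
  rw [h23, h910]
  -- With at most one point all costs vanish. This covers `l = 0`, where `t = 0` is allowed; two
  -- points force `l ≥ 1` and then `t > 0`.
  rcases le_or_gt P.card 1 with hcard | hcard
  · have : Subsingleton P := Fintype.card_le_one_iff_subsingleton.1 (by simpa using hcard)
    have hnull : ∀ {Q : (Fin t → Fin d → ℝ) → Prop}, (∀ G, Q G) → ∀ b : ℝ, b ≤ 1 →
        ENNReal.ofReal b ≤ gaussianJL t d {G | Q G} := fun hQ b hb => by
      simpa [hQ] using hb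
    refine ⟨hnull (fun G => ⟨preservesApprox_of_subsingleton _ P _ _,
      fun _ _ => preservesApprox_of_subsingleton _ P _ _⟩) _ (by norm_num),
      hnull (fun G M _ => ?_) _ (by norm_num)⟩
    rw [matchingCost_of_subsingleton, matchingCost_of_subsingleton, zero_add]
    exact mul_nonneg hε.le (optMaxMatch_nonneg _)
  have hl : 1 ≤ l := by
    by_contra hl0
    obtain rfl : l = 0 := by omega
    exact absurd (card_le_one_of_doublingNumber_le_one (by simpa using hP)) (by omega)
  have hl' : (1 : ℝ) ≤ l := by exact_mod_cast hl
  obtain ⟨p₀, hp₀⟩ := Finset.card_pos.1 (show 0 < P.card by omega)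
  have : Nonempty P := ⟨⟨p₀, hp₀⟩⟩
  obtain ⟨c, hcM, hcT⟩ := exists_center (points P)
  obtain ⟨k, hk2, hk⟩ := exists_two_pow_near hε hε1
  set Λ := Real.log (2 / ε) with hΛ
  have hlog2 : (0.6931471803 : ℝ) < Real.log 2 := Real.log_two_gt_d9
  have hle : Real.log 2 ≤ Λ := by
    apply Real.log_le_log two_pos
    rw [le_div_iff₀ hε]
    linarith
  have htε : 1000000 * (l * Λ) ≤ ε ^ 2 * t := by
    have h1 : 1000000 * (ε ^ 2)⁻¹ * l * Λ = 1000000 * (l * Λ) / ε ^ 2 := by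
      rw [div_eq_mul_inv]
      ring
    rw [h1, div_le_iff₀ (by positivity)] at ht
    linarith
  have hlΛ : (l : ℝ) * 0.69 ≤ l * Λ := by
    gcongr
    linarith
  have htt : ε ^ 2 * t ≤ t := mul_le_of_le_one_left (Nat.cast_nonneg _) (by nlinarith)
  have hεt : ε ^ 2 * t ≤ ε * t := by
    gcongr
    nlinarith
  have ht0 : 0 < t := by
    have : (0 : ℝ) < t := by linarith
    exact_mod_cast this
  -- Twenty times the leading mean `16 / 2 ^ k`, so Markov fails with probability at most `(1 + ε /
  -- 20) / 20`.
  set g : ℝ := 320 / 2 ^ k with hg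
  have hg0 : 0 < g := by positivity
  have hgε : 2 * g ≤ ε / 20 := by
    rw [hg, ← mul_div_assoc, div_le_iff₀ (by positivity)]
    rw [div_le_iff₀ hε] at hk2
    linarith
  have hsmall : gaussianJL t d {G | ¬ExpandsAtMost (Matrix.of G) P (points P c) (1 + ε / 20) g} ≤
      ENNReal.ofReal (1 / 10) := by
    refine (measure_not_expandsAtMost_le (k := k) ht0 (by positivity) (by linarith) hl ?_ P hP _
      hg0).trans (ENNReal.ofReal_le_ofReal ?_)
    · calc 8 * (l : ℝ) * (k + 1) ≤ 8 * l * (24 * Λ) := by gcongr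
        _ ≤ ε ^ 2 * t / 400 := by linarith
        _ = _ := by ring
    · have h1 : 16 * (1 + ε / 20) / 2 ^ k / g = (1 + ε / 20) / 20 := by
        rw [hg]
        field_simp
        norm_num
      rw [h1]
      linarith
  have hlarge := measure_exists_not_expandsAtMost_le (t := t) hl (by linarith) P hP (points P c)
  have hδ : 2 / (ε / 400) ^ 2 ≤ (t : ℝ) := by
    rw [div_le_iff₀ (by positivity)]
    linarith
  have h20 : 2 * (ε / 400) / (ε / 10) = 1 / 20 := by
    field_simp
    norm_num
  have hlowM := measure_optMaxMatch_lt_le P (δ := ε / 400) (μ := ε / 10) (by positivity)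
    (by linarith) (by positivity) hδ
  have hlowT := measure_optMaxTSP_lt_le P (δ := ε / 400) (μ := ε / 10) (by positivity)
    (by linarith) (by positivity) hδ
  rw [h20] at hlowM hlowT
  constructor
  -- Failure budget: `1/10` each for the small and large expansion events, `1/20` for each optimum,
  -- in total `3/10 ≤ 1/3`.
  · refine (ENNReal.ofReal_le_ofReal (by norm_num : (2 / 3 : ℝ) ≤ 1 - (1 / 10 + 1 / 10 +
      (1 / 20 + 1 / 20)))).trans (ofReal_one_sub_le_measure _ (by norm_num) ?_)
    rw [ENNReal.ofReal_add (by norm_num) (by norm_num), ENNReal.ofReal_add (by norm_num)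
      (by norm_num), ENNReal.ofReal_add (by norm_num) (by norm_num)]
    refine le_trans (measure_mono fun G hG => ?_) ((measure_union_le _ _).trans (add_le_add
      ((measure_union_le _ _).trans (add_le_add hsmall hlarge))
      ((measure_union_le _ _).trans (add_le_add hlowM hlowT))))
    by_contra hcon
    simp only [Set.mem_union, Set.mem_ofPred_eq, not_or, not_not, not_exists, not_lt] at hcon
    exact hG (preservesApprox_of_expandsAtMost hε hε1 hg0.le hgε hcM hcT hcon.1.1 hcon.1.2
      hcon.2.1 hcon.2.2)
  · refine (ENNReal.ofReal_le_ofReal (by norm_num : (9 / 10 : ℝ) ≤ 1 - 1 / 10)).trans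
      (ofReal_one_sub_le_measure _ (by norm_num) ((measure_mono fun G hG => ?_).trans hsmall))
    -- The small-expansion event alone suffices: the errors `ε / 20` and `2 g ≤ ε / 20` are both
    -- relative to the optimum.
    refine fun hexp => hG fun M hM => (hexp.matchingCost_le hg0.le hcM hM).trans ?_
    have h1 := matchingCost_le_optMaxMatch (points P) hM
    have h2 := optMaxMatch_nonneg (points P)
    have h3 : ε / 20 * matchingCost (points P) M ≤ ε / 20 * optMaxMatch (points P) := by gcongr
    have h4 : 2 * g * optMaxMatch (points P) ≤ ε / 20 * optMaxMatch (points P) := by gcongr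
    have h5 := mul_nonneg hε.le h2
    linarith
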